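/- For a Lebesgue measurable set $\Omega\subset\mathbb R^2$ let $|\Omega|$ be its area, $\chi_\Omega$ its characteristic function, and $$P(\Omega)=\sup\Big\{\int_\Omega \nabla\cdot\phi\,dx:\ \phi\in C^1_c(\mathbb R^2;\mathbb R^2),\ |\phi|\le 1\Big\}$$ its perimeter; $\Omega$ has finite perimeter if $P(\Omega)<\infty$. For $\lambda>0$ and $0<\delta<\frac12$ let $$E_{\lambda,\delta}(\Omega)=P(\Omega)-\frac{\lambda}{4|\log\delta|}\int_{\mathbb R^2}\int_{\mathbb R^2}|\chi_\Omega(x+z)-\chi_\Omega(x)|^2\,\frac{g_\delta(|z|)}{|z|^3}\,dz\,dx,\qquad g_\delta(r)=\chi_{(1,\infty)}(r/\delta).$$ For $m>0$ a generalized minimizer of $E_{\lambda,\delta}$ at mass $m$ is a minimizer of $\sum_{i} E_{\lambda,\delta}(\Omega_i)$ among all sequences $(\Omega_i)_{i\in\mathbb N}$ of sets of finite perimeter of which at most finitely many have positive area and for which $\sum_i|\Omega_i|=m$; the $\Omega_i$ are its components. Write $B_r(a)$ for the disk of radius $r$ about $a$; a set $\Omega$ is said to contain $B_r(a)$ if $|B_r(a)\setminus\Omega|=0$.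 There is a universal constant $C>0$ such that for every $\lambda>1$ there is $\delta_0=\delta_0(\lambda)>0$ with the following properties for all $0<\delta<\delta_0$. (i) If a set $\Omega\subset\mathbb R^2$ of finite perimeter contains a disk $B_r(a)$ with $r\ge C\delta^{\frac{\lambda-1}{\lambda}}$, then there is $0<\tilde r<r$ such that $\widetilde\Omega=\Omega\setminus B_{\tilde r}(a)$ has finite perimeter and $$|\Omega|=|\widetilde\Omega|+|B_{\tilde r}(0)|,\qquad E_{\lambda,\delta}(\Omega)>E_{\lambda,\delta}(\widetilde\Omega)+E_{\lambda,\delta}(B_{\tilde r}(0)).$$ (ii) For every $m>0$, no component of a generalized minimizer of $E_{\lambda,\delta}$ at mass $m$ contains a disk of radius $r\ge C\delta^{\frac{\lambda-1}{\lambda}}$. In particular, for every $\lambda>1$ and $\rho>0$ there is $\delta_1>0$ such that for all $0<\delta<\delta_1$ and all $m>0$ no component of a generalized minimizer of $E_{\lambda,\delta}$ at mass $m$ contains a disk of radius $\rho$. -/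

import Mathlib

open MeasureTheory Set

noncomputable section

namespace Dipolar

/-- The Euclidean plane. -/
abbrev Plane : Type := EuclideanSpace ℝ (Fin 2)

/-- The divergence of a vector field on the plane. -/
def divergence (φ : Plane → Plane) (x : Plane) : ℝ :=
  ∑ i : Fin 2, (fderiv ℝ φ x (EuclideanSpace.single i 1)) i

/-- The perimeter of a (Lebesgue measurable) set in the sense of De Giorgi, with values in `[0, ∞]`.
Because of the field `φ = 0` the supremum is nonnegative, so truncating each term at `0` does not
change it. -/
def perimeter (Ω : Set Plane) : ENNReal :=
  ⨆ (φ : Plane → Plane) (_ : ContDiff ℝ 1 φ ∧ HasCompactSupport φ ∧ ∀ x, ‖φ x‖ ≤ 1),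
    ENNReal.ofReal (∫ x in Ω, divergence φ x)

/-- Sets of finite perimeter: Lebesgue measurable sets whose perimeter is finite. -/
def HasFinitePerimeter (Ω : Set Plane) : Prop :=
  NullMeasurableSet Ω volume ∧ perimeter Ω < ⊤

/-- The characteristic function of a set. -/
def chi (Ω : Set Plane) : Plane → ℝ := Ω.indicator 1

/-- The cutoff `g_δ(r) = g(r / δ)` with `g` the characteristic function of `(1, ∞)`. -/
def cutoff (δ r : ℝ) : ℝ := (Ioi (1 : ℝ)).indicator 1 (r / δ)

/-- The double integral of `|χ_Ω(x + z) - χ_Ω(x)|² g_δ(|z|) / |z|³` over `z` and `x`. -/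
def nonlocalTerm (δ : ℝ) (Ω : Set Plane) : ENNReal :=
  ∫⁻ x : Plane, ∫⁻ z : Plane,
    ENNReal.ofReal (|chi Ω (x + z) - chi Ω x| ^ 2 * (cutoff δ ‖z‖ / ‖z‖ ^ 3))

/-- The energy `E_{lam,δ}`. For a set of finite perimeter in the plane and `δ > 0`, the perimeter and
the nonlocal term are both finite, since the set or its complement has finite area. -/
def energy (lam δ : ℝ) (Ω : Set Plane) : ℝ :=
  (perimeter Ω).toReal - lam / (4 * |Real.log δ|) * (nonlocalTerm δ Ω).toReal

/-- The admissible sequences `(Ω_i)` of total mass `m`: sets of finite perimeter, at most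
finitely many of which have positive area. -/
def SA (m : ℝ) : Set (ℕ → Set Plane) :=
  {Ω | (∀ i, HasFinitePerimeter (Ω i)) ∧ {i | 0 < volume (Ω i)}.Finite ∧
    ∑' i, volume (Ω i) = ENNReal.ofReal m}

/-- `S E (Ω_i) = ∑ E (Ω_i)`. -/
def sumEnergy (E : Set Plane → ℝ) (Ω : ℕ → Set Plane) : ℝ := ∑' i, E (Ω i)

/-- Generalized minimizers of `E` at mass `m`: minimizers of `S E` over `SA m`. -/
def IsGeneralizedMinimizer (E : Set Plane → ℝ) (m : ℝ) (Ω : ℕ → Set Plane) : Prop :=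
  Ω ∈ SA m ∧ ∀ Ω' ∈ SA m, sumEnergy E Ω ≤ sumEnergy E Ω'

/-- `Ω` contains the disk of radius `r` about `a`, up to a null set. -/
def ContainsDisk (Ω : Set Plane) (a : Plane) (r : ℝ) : Prop :=
  volume (Metric.ball a r \ Ω) = 0

end Dipolar

end

namespace Dipolar

open scoped ENNReal

/-! Take `R = r / 2` and cut the disk `B` of radius `R` out of `Ω`, placing it far away as a
separate component. Each of the two new boundary circles has length `2πR`, so the total perimeter
grows by at most `4πR`. The nonlocal term gains four times the interaction of `B` with `Ω \ B`,
because these two pieces now see each other as exterior (`nonlocalTerm_diff_add`). As `Ω` contains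
the concentric disk of radius `2R`, this interaction is at least that of `B` with the surrounding
annulus.

That last quantity is estimated displacement by displacement: a shift of length `t ≤ 2R` pushes area
at least `(2R - t)t` out of the disk, and integrating against the kernel over `δ < t < R` gives
`2π(2R log(R/δ) - (R - δ))` (`interaction_ball_annulus_ge`). The energy therefore drops as soon as
`λ/|log δ|` times this number exceeds `4πR`. For `R ≥ 2δ^((λ-1)/λ)` the logarithm is at least `|log
δ|/λ + log 2`; its first part balances the perimeter exactly, and `2 log 2 > 1` absorbs the error `R
- δ` (`lt_interaction_bound`). A component of a generalized minimizer cannot be split in this way,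
since one of the infinitely many null slots can receive the disk.

The energy is a difference of `toReal`s, so the nonlocal terms must be shown finite. The kernel is
integrable, so it suffices that a set of finite perimeter or its complement has finite area
(`volume_lt_top_or_compl_of_perimeter_lt_top`). This is proved by slicing: the perimeter bounds the
measure of the set of axis-parallel lines on which the set is neither null nor conull. -/

/-- The plane in Cartesian coordinates. -/
noncomputable def planeEquiv : Plane ≃ᵐ ℝ × ℝ :=
  (MeasurableEquiv.toLp 2 (Fin 2 → ℝ)).symm.trans MeasurableEquiv.finTwoArrow

lemma planeEquiv_symm_apply (q : ℝ × ℝ) : planeEquiv.symm q = !₂[q.1, q.2] := rfl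

lemma measurePreserving_planeEquiv : MeasurePreserving planeEquiv volume volume :=
  (EuclideanSpace.volume_preserving_symm_measurableEquiv_toLp (Fin 2)).trans
    (volume_preserving_finTwoArrow ℝ)

/-! ### Test fields and elementary properties of the perimeter. -/

/-- The admissible test fields in the definition of the perimeter. -/
def IsTestField (φ : Plane → Plane) : Prop :=
  ContDiff ℝ 1 φ ∧ HasCompactSupport φ ∧ ∀ x, ‖φ x‖ ≤ 1

lemma IsTestField.neg {φ : Plane → Plane} (h : IsTestField φ) : IsTestField (-φ) :=
  ⟨h.1.neg, h.2.1.neg, fun x => by simpa using h.2.2 x⟩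

lemma IsTestField.comp_add_right {φ : Plane → Plane} (h : IsTestField φ) (a : Plane) :
    IsTestField (fun x => φ (x + a)) :=
  ⟨h.1.comp (contDiff_id.add contDiff_const),
    h.2.1.comp_homeomorph (Homeomorph.addRight a), fun _ => h.2.2 _⟩

lemma divergence_neg (φ : Plane → Plane) (x : Plane) :
    divergence (-φ) x = -divergence φ x := by
  simp [divergence, fderiv_neg]

lemma divergence_comp_add_right (φ : Plane → Plane) (a x : Plane) :
    divergence (fun y => φ (y + a)) x = divergence φ (x + a) := by
  simp only [divergence, fderiv_comp_add_right]

lemma continuous_divergence {φ : Plane → Plane} (h : ContDiff ℝ 1 φ) :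
    Continuous (divergence φ) := by
  have := h.continuous_fderiv one_ne_zero
  unfold divergence
  fun_prop

lemma hasCompactSupport_divergence {φ : Plane → Plane} (h : HasCompactSupport φ) :
    HasCompactSupport (divergence φ) :=
  (h.fderiv (𝕜 := ℝ)).comp_left
    (g := fun T : Plane →L[ℝ] Plane => ∑ i : Fin 2, (T (EuclideanSpace.single i 1)) i) (by simp)

lemma IsTestField.integrable_divergence {φ : Plane → Plane} (h : IsTestField φ) :
    Integrable (divergence φ) :=
  (continuous_divergence h.1).integrable_of_hasCompactSupport (hasCompactSupport_divergence h.2.1)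

lemma le_perimeter {φ : Plane → Plane} (h : IsTestField φ) (Ω : Set Plane) :
    ENNReal.ofReal (∫ x in Ω, divergence φ x) ≤ perimeter Ω :=
  le_iSup₂_of_le (f := fun (φ : Plane → Plane)
    (_ : ContDiff ℝ 1 φ ∧ HasCompactSupport φ ∧ ∀ x, ‖φ x‖ ≤ 1) =>
      ENNReal.ofReal (∫ x in Ω, divergence φ x)) φ h le_rfl

lemma perimeter_le {Ω : Set Plane} {M : ℝ≥0∞}
    (h : ∀ φ, IsTestField φ → ENNReal.ofReal (∫ x in Ω, divergence φ x) ≤ M) :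
    perimeter Ω ≤ M := iSup₂_le h

lemma perimeter_congr {Ω Ω' : Set Plane} (h : Ω =ᵐ[volume] Ω') :
    perimeter Ω = perimeter Ω' := by
  unfold perimeter
  simp only [setIntegral_congr_set h]

lemma perimeter_eq_zero_of_null {Ω : Set Plane} (h : volume Ω = 0) : perimeter Ω = 0 :=
  le_antisymm (perimeter_le fun φ _ => by simp [setIntegral_measure_zero _ h]) zero_le

/-- The flux of `φ` through `Ω \ B` is that of `φ` through `Ω` plus that of `-φ` through `B`, and
both fields are admissible. -/
lemma perimeter_diff_le {Ω B : Set Plane} (hB : MeasurableSet B) (hsub : B ≤ᵐ[volume] Ω) :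
    perimeter (Ω \ B) ≤ perimeter Ω + perimeter B := by
  refine perimeter_le fun φ hφ => ?_
  have hi := hφ.integrable_divergence
  have hinter : (Ω ∩ B : Set Plane) =ᵐ[volume] B := by
    filter_upwards [hsub] with x hx
    exact propext ⟨fun h => h.2, fun h => ⟨hx h, h⟩⟩
  have h1 := integral_inter_add_sdiff (s := Ω) (t := B) hB hi.integrableOn
  rw [setIntegral_congr_set hinter] at h1
  have h2 : ∫ x in B, divergence (-φ) x = -∫ x in B, divergence φ x := by
    simp only [divergence_neg, integral_neg]
  have h3 : ∫ x in Ω \ B, divergence φ x =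
      (∫ x in Ω, divergence φ x) + ∫ x in B, divergence (-φ) x := by linarith
  rw [h3]
  exact ENNReal.ofReal_add_le.trans (add_le_add (le_perimeter hφ Ω) (le_perimeter hφ.neg B))

/-! ### The perimeter of a disk, by the divergence theorem in polar coordinates. -/

/-- Polar coordinates on the plane. -/
noncomputable def polar (r θ : ℝ) : Plane := !₂[r * Real.cos θ, r * Real.sin θ]

/-- The radial unit vector. -/
noncomputable def radial (θ : ℝ) : Plane := !₂[Real.cos θ, Real.sin θ]

lemma norm_radial (θ : ℝ) : ‖radial θ‖ = 1 := by
  simp [radial, EuclideanSpace.norm_eq]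

lemma norm_polar {r : ℝ} (hr : 0 ≤ r) (θ : ℝ) : ‖polar r θ‖ = r := by
  have : polar r θ = r • radial θ := by
    ext i; fin_cases i <;> simp [polar, radial]
  rw [this, norm_smul, norm_radial, Real.norm_of_nonneg hr, mul_one]

lemma hasDerivAt_polar_radius (r θ : ℝ) :
    HasDerivAt (fun s => polar s θ) (radial θ) r := by
  have h : HasDerivAt (fun s : ℝ => (![s * Real.cos θ, s * Real.sin θ] : Fin 2 → ℝ))
      ![Real.cos θ, Real.sin θ] r := by
    rw [hasDerivAt_pi]
    intro i
    fin_cases i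
    · simpa using (hasDerivAt_id r).mul_const (Real.cos θ)
    · simpa using (hasDerivAt_id r).mul_const (Real.sin θ)
  exact ((PiLp.continuousLinearEquiv 2 ℝ (fun _ : Fin 2 => ℝ)).symm.hasFDerivAt).comp_hasDerivAt r h

lemma hasDerivAt_polar_angle (r θ : ℝ) :
    HasDerivAt (fun s => polar r s) (!₂[-(r * Real.sin θ), r * Real.cos θ] : Plane) θ := by
  have h : HasDerivAt (fun s : ℝ => (![r * Real.cos s, r * Real.sin s] : Fin 2 → ℝ))
      ![-(r * Real.sin θ), r * Real.cos θ] θ := by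
    rw [hasDerivAt_pi]
    intro i
    fin_cases i
    · simpa using (Real.hasDerivAt_cos θ).const_mul r
    · simpa using (Real.hasDerivAt_sin θ).const_mul r
  exact ((PiLp.continuousLinearEquiv 2 ℝ (fun _ : Fin 2 => ℝ)).symm.hasFDerivAt).comp_hasDerivAt θ h

lemma continuous_polar : Continuous (fun q : ℝ × ℝ => polar q.1 q.2) := by
  unfold polar
  refine (PiLp.continuous_toLp 2 _).comp (continuous_pi fun i => ?_)
  fin_cases i <;> simp <;> fun_prop

lemma setIntegral_ball_eq_polar (g : Plane → ℝ) (R : ℝ) :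
    ∫ x in Metric.ball (0 : Plane) R, g x =
      ∫ q in Ioo 0 R ×ˢ Ioo (-Real.pi) Real.pi, q.1 * g (polar q.1 q.2) := by
  rw [← integral_indicator measurableSet_ball,
    ← (measurePreserving_planeEquiv.symm).integral_comp' (f := planeEquiv.symm),
    ← integral_comp_polarCoord_symm, polarCoord_target]
  have hsub : Ioo 0 R ×ˢ Ioo (-Real.pi) Real.pi ⊆ Ioi (0:ℝ) ×ˢ Ioo (-Real.pi) Real.pi :=
    prod_mono_left Ioo_subset_Ioi_self
  rw [setIntegral_eq_of_subset_of_forall_sdiff_eq_zero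
    (measurableSet_Ioi.prod measurableSet_Ioo) hsub]
  · refine setIntegral_congr_fun (measurableSet_Ioo.prod measurableSet_Ioo) fun q hq => ?_
    have h0 : planeEquiv.symm (polarCoord.symm q) = polar q.1 q.2 := rfl
    simp only [h0, smul_eq_mul]
    rw [indicator_of_mem]
    simpa [norm_polar hq.1.1.le] using hq.1.2
  · intro q hq
    have h0 : planeEquiv.symm (polarCoord.symm q) = polar q.1 q.2 := rfl
    simp only [h0, smul_eq_mul]
    rw [indicator_of_notMem, mul_zero]
    intro hmem
    have hpos : (0:ℝ) < q.1 := hq.1.1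
    simp only [mem_ball_zero_iff, norm_polar hpos.le] at hmem
    exact hq.2 ⟨⟨hpos, hmem⟩, hq.1.2⟩

lemma ofLp_apply_eq_add (T : Plane →L[ℝ] Plane) (a b : ℝ) (i : Fin 2) :
    (T (!₂[a, b] : Plane)) i =
      a * (T (EuclideanSpace.single 0 1)) i + b * (T (EuclideanSpace.single 1 1)) i := by
  have : (!₂[a, b] : Plane) = a • EuclideanSpace.single 0 1 + b • EuclideanSpace.single 1 1 := by
    ext j; fin_cases j <;> simp
  rw [this, map_add, map_smul, map_smul]
  simp

lemma hasDerivAt_plane_apply {γ : ℝ → Plane} {v : Plane} {t : ℝ} (h : HasDerivAt γ v t)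
    (i : Fin 2) : HasDerivAt (fun s => γ s i) (v i) t :=
  (EuclideanSpace.proj (𝕜 := ℝ) i).hasFDerivAt.comp_hasDerivAt t h

section BallPerimeter

variable (φ : Plane → Plane)

/-- The derivative in `r` of `r` times the radial component of `φ`. -/
noncomputable def radialPart (q : ℝ × ℝ) : ℝ :=
  (φ (polar q.1 q.2) 0 * Real.cos q.2 + φ (polar q.1 q.2) 1 * Real.sin q.2) +
    q.1 * ((fderiv ℝ φ (polar q.1 q.2) (radial q.2)) 0 * Real.cos q.2 +
      (fderiv ℝ φ (polar q.1 q.2) (radial q.2)) 1 * Real.sin q.2)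

/-- The derivative in `θ` of the angular component of `φ`. -/
noncomputable def angularPart (q : ℝ × ℝ) : ℝ :=
  q.1 * divergence φ (polar q.1 q.2) - radialPart φ q

variable {φ}

lemma hasDerivAt_radialPart (h : ContDiff ℝ 1 φ) (r θ : ℝ) :
    HasDerivAt (fun s => s * (φ (polar s θ) 0 * Real.cos θ + φ (polar s θ) 1 * Real.sin θ))
      (radialPart φ (r, θ)) r := by
  have h1 : HasDerivAt (fun s => φ (polar s θ)) (fderiv ℝ φ (polar r θ) (radial θ)) r :=
    ((h.differentiable one_ne_zero _).hasFDerivAt).comp_hasDerivAt r (hasDerivAt_polar_radius r θ)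
  have h2 := (hasDerivAt_id r).mul (((hasDerivAt_plane_apply h1 0).mul_const (Real.cos θ)).add
    ((hasDerivAt_plane_apply h1 1).mul_const (Real.sin θ)))
  refine h2.congr_deriv ?_
  simp [radialPart]

/-- This is the polar formula `r div φ = ∂_r (r φ_r) + ∂_θ φ_θ`: `angularPart` is defined as a
remainder, and here it is recognized as a derivative in the angle. -/
lemma hasDerivAt_angularPart (h : ContDiff ℝ 1 φ) (r θ : ℝ) :
    HasDerivAt (fun s => φ (polar r s) 1 * Real.cos s - φ (polar r s) 0 * Real.sin s)
      (angularPart φ (r, θ)) θ := by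
  have h1 : HasDerivAt (fun s => φ (polar r s))
      (fderiv ℝ φ (polar r θ) (!₂[-(r * Real.sin θ), r * Real.cos θ] : Plane)) θ :=
    ((h.differentiable one_ne_zero _).hasFDerivAt).comp_hasDerivAt θ (hasDerivAt_polar_angle r θ)
  have h2 := ((hasDerivAt_plane_apply h1 1).mul (Real.hasDerivAt_cos θ)).sub
    ((hasDerivAt_plane_apply h1 0).mul (Real.hasDerivAt_sin θ))
  refine h2.congr_deriv ?_
  simp only [angularPart, radialPart, radial, divergence, ofLp_apply_eq_add, Fin.sum_univ_two]
  have := Real.sin_sq_add_cos_sq θ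
  linear_combination (-(r * (fderiv ℝ φ (polar r θ) (EuclideanSpace.single 0 1)) 0) -
    r * (fderiv ℝ φ (polar r θ) (EuclideanSpace.single 1 1)) 1) * (-this)

lemma continuous_radialPart (h : ContDiff ℝ 1 φ) : Continuous (radialPart φ) := by
  have h1 := h.continuous_fderiv one_ne_zero
  have h2 := h.continuous
  have h3 := continuous_polar
  have h4 : Continuous radial := by
    refine (PiLp.continuous_toLp 2 _).comp (continuous_pi fun i => ?_)
    fin_cases i <;> simp <;> fun_prop
  have h5 : Continuous fun q : ℝ × ℝ => φ (polar q.1 q.2) := h2.comp h3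
  have h6 : Continuous fun q : ℝ × ℝ => fderiv ℝ φ (polar q.1 q.2) (radial q.2) :=
    (h1.comp h3).clm_apply (h4.comp continuous_snd)
  unfold radialPart
  fun_prop

lemma continuous_angularPart (h : ContDiff ℝ 1 φ) : Continuous (angularPart φ) :=
  (continuous_fst.mul ((continuous_divergence h).comp continuous_polar)).sub
    (continuous_radialPart h)

lemma integrableOn_rectangle_of_continuous {f : ℝ × ℝ → ℝ} (hf : Continuous f) (a b c d : ℝ) :
    IntegrableOn f (Ioo a b ×ˢ Ioo c d) (volume.prod volume) :=
  (hf.continuousOn.integrableOn_compact (isCompact_Icc.prod isCompact_Icc)).mono_set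
    (prod_mono Ioo_subset_Icc_self Ioo_subset_Icc_self)

/-- On each circle the integrand is the derivative of a `2π`-periodic function. -/
lemma setIntegral_angularPart (h : ContDiff ℝ 1 φ) (R : ℝ) :
    ∫ q in Ioo 0 R ×ˢ Ioo (-Real.pi) Real.pi, angularPart φ q = 0 := by
  rw [Measure.volume_eq_prod, setIntegral_prod _
    (integrableOn_rectangle_of_continuous (continuous_angularPart h) _ _ _ _)]
  refine integral_eq_zero_of_ae (Filter.Eventually.of_forall fun r => ?_)
  have hc : Continuous fun θ => angularPart φ (r, θ) :=
    (continuous_angularPart h).comp (by fun_prop)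
  have hi := intervalIntegral.integral_eq_sub_of_hasDerivAt (a := -Real.pi) (b := Real.pi)
    (fun θ _ => hasDerivAt_angularPart h r θ) (hc.intervalIntegrable _ _)
  rw [intervalIntegral.integral_of_le (by linarith [Real.pi_pos]),
    integral_Ioc_eq_integral_Ioo] at hi
  simp only [Pi.zero_apply]
  rw [hi]
  simp [polar]

/-- Along each ray the integral is the boundary value `R φ_r`, which is at most `R` because `|φ| ≤
1`. -/
lemma setIntegral_radialPart_le (h : IsTestField φ) {R : ℝ} (hR : 0 ≤ R) :
    ∫ q in Ioo 0 R ×ˢ Ioo (-Real.pi) Real.pi, radialPart φ q ≤ 2 * Real.pi * R := by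
  have hint := integrableOn_rectangle_of_continuous (continuous_radialPart h.1)
    0 R (-Real.pi) Real.pi
  have hswap : IntegrableOn (fun q : ℝ × ℝ => radialPart φ q.swap)
      (Ioo (-Real.pi) Real.pi ×ˢ Ioo 0 R) (volume.prod volume) := hint.swap
  rw [Measure.volume_eq_prod, ← setIntegral_prod_swap, setIntegral_prod _ hswap]
  have hθ : ∀ θ : ℝ, ∫ r in Ioo 0 R, radialPart φ (Prod.swap (θ, r)) ≤ R := by
    intro θ
    have hc : Continuous fun r => radialPart φ (r, θ) :=
      (continuous_radialPart h.1).comp (by fun_prop)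
    have hi := intervalIntegral.integral_eq_sub_of_hasDerivAt (a := 0) (b := R)
      (fun r _ => hasDerivAt_radialPart h.1 r θ) (hc.intervalIntegrable _ _)
    rw [intervalIntegral.integral_of_le hR, integral_Ioc_eq_integral_Ioo] at hi
    simp only [Prod.swap_prod_mk]
    rw [hi]
    have hin : φ (polar R θ) 0 * Real.cos θ + φ (polar R θ) 1 * Real.sin θ =
        inner ℝ (radial θ) (φ (polar R θ)) := by
      simp [radial, PiLp.inner_apply, Fin.sum_univ_two]
    rw [hin]
    have hle := (real_inner_le_norm (radial θ) (φ (polar R θ)))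
    rw [norm_radial, one_mul] at hle
    nlinarith [h.2.2 (polar R θ)]
  calc _ ≤ ∫ _ in Ioo (-Real.pi) Real.pi, R :=
        setIntegral_mono (by
          rw [IntegrableOn, ← Measure.prod_restrict] at hswap
          exact hswap.integral_prod_left) (by simp) hθ
    _ = _ := by
      rw [setIntegral_const, Real.volume_real_Ioo_of_le (by linarith [Real.pi_pos]), smul_eq_mul]
      ring

lemma setIntegral_divergence_ball_le (h : IsTestField φ) {R : ℝ} (hR : 0 ≤ R) :
    ∫ x in Metric.ball (0 : Plane) R, divergence φ x ≤ 2 * Real.pi * R := by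
  rw [setIntegral_ball_eq_polar]
  have hsum : (fun q : ℝ × ℝ => q.1 * divergence φ (polar q.1 q.2)) =
      fun q => radialPart φ q + angularPart φ q := by
    ext q; simp [angularPart]
  rw [hsum, Measure.volume_eq_prod, integral_add
    (integrableOn_rectangle_of_continuous (continuous_radialPart h.1) _ _ _ _)
    (integrableOn_rectangle_of_continuous (continuous_angularPart h.1) _ _ _ _),
    ← Measure.volume_eq_prod, setIntegral_angularPart h.1, add_zero]
  exact setIntegral_radialPart_le h hR

end BallPerimeter

lemma perimeter_ball_le (a : Plane) {R : ℝ} (hR : 0 ≤ R) :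
    perimeter (Metric.ball a R) ≤ ENNReal.ofReal (2 * Real.pi * R) := by
  refine perimeter_le fun φ hφ => ENNReal.ofReal_le_ofReal ?_
  have hmp := measurePreserving_add_right (volume : Measure Plane) a
  have hpre : (· + a) ⁻¹' Metric.ball a R = Metric.ball (0 : Plane) R := by
    ext x; simp
  rw [← hmp.setIntegral_preimage_emb (Homeomorph.addRight a).measurableEmbedding, hpre]
  simp only [← divergence_comp_add_right]
  exact setIntegral_divergence_ball_le (hφ.comp_add_right a) hR

end Dipolar

namespace Dipolar

open scoped ENNReal

/-! ### The nonlocal term as an interaction of a set with its complement. -/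

/-- The kernel `g_δ(|w|) / |w|³` with values in `[0, ∞]`. -/
noncomputable def kernel (δ : ℝ) (w : Plane) : ℝ≥0∞ := ENNReal.ofReal (cutoff δ ‖w‖ / ‖w‖ ^ 3)

/-- The interaction of two sets through the kernel. -/
noncomputable def interaction (δ : ℝ) (A B : Set Plane) : ℝ≥0∞ :=
  ∫⁻ x in A, ∫⁻ y in B, kernel δ (y - x)

lemma measurable_cutoff (δ : ℝ) : Measurable (cutoff δ) :=
  (measurable_one.indicator measurableSet_Ioi).comp (measurable_id.div_const δ)

@[fun_prop]
lemma measurable_kernel (δ : ℝ) : Measurable (kernel δ) :=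
  (((measurable_cutoff δ).comp measurable_norm).div (measurable_norm.pow_const 3)).ennreal_ofReal

lemma kernel_neg (δ : ℝ) (w : Plane) : kernel δ (-w) = kernel δ w := by
  simp [kernel]

lemma cutoff_of_lt {δ r : ℝ} (hδ : 0 < δ) (h : δ < r) : cutoff δ r = 1 := by
  rw [cutoff, indicator_of_mem (by rwa [mem_Ioi, one_lt_div hδ])]
  rfl

lemma cutoff_of_le {δ r : ℝ} (hδ : 0 < δ) (h : r ≤ δ) : cutoff δ r = 0 :=
  indicator_of_notMem (by rw [mem_Ioi, one_lt_div hδ]; exact h.not_gt) _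

lemma interaction_comm (δ : ℝ) (A B : Set Plane) : interaction δ A B = interaction δ B A := by
  unfold interaction
  rw [lintegral_lintegral_swap]
  · refine lintegral_congr fun x => lintegral_congr fun y => ?_
    rw [← kernel_neg, neg_sub]
  · exact ((measurable_kernel δ).comp (measurable_snd.sub measurable_fst)).aemeasurable

lemma interaction_mono {δ : ℝ} {A A' B B' : Set Plane} (hA : A ⊆ A') (hB : B ⊆ B') :
    interaction δ A B ≤ interaction δ A' B' :=
  (lintegral_mono fun _ => lintegral_mono_set hB).trans (lintegral_mono_set hA)

lemma interaction_union_left (δ : ℝ) {A B : Set Plane} (C : Set Plane) (hB : MeasurableSet B)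
    (h : Disjoint A B) : interaction δ (A ∪ B) C = interaction δ A C + interaction δ B C :=
  lintegral_union hB h

lemma interaction_union_right (δ : ℝ) {A B : Set Plane} (C : Set Plane) (hB : MeasurableSet B)
    (h : Disjoint A B) : interaction δ C (A ∪ B) = interaction δ C A + interaction δ C B := by
  rw [interaction_comm, interaction_union_left δ C hB h, interaction_comm δ A,
    interaction_comm δ B]

/-- With `y = x + z`, only pairs with exactly one of `x`, `y` in `Ω` contribute, and the two cases
are equal because the kernel is even. -/
lemma nonlocalTerm_eq_interaction (δ : ℝ) {Ω : Set Plane} (hΩ : MeasurableSet Ω) :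
    nonlocalTerm δ Ω = 2 * interaction δ Ω Ωᶜ := by
  have hin : ∀ x : Plane, ∫⁻ z : Plane,
      ENNReal.ofReal (|chi Ω (x + z) - chi Ω x| ^ 2 * (cutoff δ ‖z‖ / ‖z‖ ^ 3)) =
      ∫⁻ y, ENNReal.ofReal (|chi Ω y - chi Ω x| ^ 2) * kernel δ (y - x) := by
    intro x
    rw [← lintegral_add_left_eq_self
      (fun y => ENNReal.ofReal (|chi Ω y - chi Ω x| ^ 2) * kernel δ (y - x)) x]
    refine lintegral_congr fun z => ?_
    rw [ENNReal.ofReal_mul (by positivity), add_sub_cancel_left, kernel]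
  have hmem : ∀ x ∈ Ω, ∫⁻ y, ENNReal.ofReal (|chi Ω y - chi Ω x| ^ 2) * kernel δ (y - x) =
      ∫⁻ y in Ωᶜ, kernel δ (y - x) := by
    intro x hx
    rw [← lintegral_indicator hΩ.compl]
    refine lintegral_congr fun y => ?_
    by_cases hy : y ∈ Ω <;> simp [chi, hx, hy]
  have hnmem : ∀ x ∈ Ωᶜ, ∫⁻ y, ENNReal.ofReal (|chi Ω y - chi Ω x| ^ 2) * kernel δ (y - x) =
      ∫⁻ y in Ω, kernel δ (y - x) := by
    intro x hx
    rw [← lintegral_indicator hΩ]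
    refine lintegral_congr fun y => ?_
    have hx' : x ∉ Ω := hx
    by_cases hy : y ∈ Ω <;> simp [chi, hx', hy]
  unfold nonlocalTerm
  simp only [hin]
  rw [← lintegral_add_compl _ hΩ, setLIntegral_congr_fun hΩ hmem,
    setLIntegral_congr_fun hΩ.compl hnmem, two_mul]
  congr 1
  exact interaction_comm δ Ωᶜ Ω

lemma nonlocalTerm_congr (δ : ℝ) {Ω Ω' : Set Plane} (h : Ω =ᵐ[volume] Ω') :
    nonlocalTerm δ Ω = nonlocalTerm δ Ω' := by
  have hchi : chi Ω =ᵐ[volume] chi Ω' := indicator_ae_eq_of_ae_eq_set h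
  unfold nonlocalTerm
  refine lintegral_congr_ae ?_
  filter_upwards [hchi] with x hx
  refine lintegral_congr_ae ?_
  have := (measurePreserving_add_left (volume : Measure Plane) x).quasiMeasurePreserving.ae hchi
  filter_upwards [this] with z hz
  rw [hx, hz]

lemma energy_congr (lam δ : ℝ) {Ω Ω' : Set Plane} (h : Ω =ᵐ[volume] Ω') :
    energy lam δ Ω = energy lam δ Ω' := by
  rw [energy, energy, perimeter_congr h, nonlocalTerm_congr δ h]

lemma energy_eq_zero_of_null (lam δ : ℝ) {Ω : Set Plane} (h : volume Ω = 0) :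
    energy lam δ Ω = 0 := by
  rw [energy_congr lam δ (ae_eq_empty.2 h), energy, perimeter_eq_zero_of_null measure_empty]
  simp [nonlocalTerm, chi]

/-- Cutting a subset out of a set changes the nonlocal term by the interaction of the parts. -/
lemma nonlocalTerm_diff_add (δ : ℝ) {Ω B : Set Plane} (hΩ : MeasurableSet Ω)
    (hB : MeasurableSet B) (hsub : B ⊆ Ω) :
    nonlocalTerm δ (Ω \ B) + nonlocalTerm δ B =
      nonlocalTerm δ Ω + 4 * interaction δ B (Ω \ B) := by
  have hA := hΩ.diff hB
  rw [nonlocalTerm_eq_interaction δ hΩ, nonlocalTerm_eq_interaction δ hB,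
    nonlocalTerm_eq_interaction δ hA]
  have hd : Disjoint (Ω \ B) B := disjoint_sdiff_left
  have e1 : Ω \ B ∪ B = Ω := sdiff_union_of_subset hsub
  have e2 : (Ω \ B)ᶜ = Ωᶜ ∪ B := by
    ext x; simp only [mem_compl_iff, mem_sdiff, mem_union]; tauto
  have e3 : Bᶜ = Ωᶜ ∪ Ω \ B := by
    ext x
    have := @hsub x
    simp only [mem_compl_iff, mem_sdiff, mem_union]; tauto
  have i1 : interaction δ Ω Ωᶜ = interaction δ (Ω \ B) Ωᶜ + interaction δ B Ωᶜ := by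
    conv_lhs => rw [← e1]
    rw [interaction_union_left δ _ hB hd, e1]
  have i2 : interaction δ (Ω \ B) (Ω \ B)ᶜ =
      interaction δ (Ω \ B) Ωᶜ + interaction δ B (Ω \ B) := by
    rw [e2, interaction_union_right δ _ hB (disjoint_compl_left.mono_right hsub),
      interaction_comm δ B]
  have i3 : interaction δ B Bᶜ = interaction δ B Ωᶜ + interaction δ B (Ω \ B) := by
    conv_lhs => rw [e3]
    rw [interaction_union_right δ _ hA (disjoint_compl_left.mono_right sdiff_subset)]
  rw [i1, i2, i3]
  ring

/-- The cutoff removes the singularity at the origin, and cubic decay is integrable at infinity in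
dimension two. -/
lemma lintegral_kernel_lt_top {δ : ℝ} (hδ : 0 < δ) : ∫⁻ w, kernel δ w < ⊤ := by
  have hint : Integrable (fun w : Plane => (1 + ‖w‖) ^ (-(3:ℝ))) :=
    integrable_one_add_norm (by simp; norm_num)
  have hint' := hint.const_mul ((1 + 1 / δ) ^ 3)
  refine lt_of_le_of_lt (lintegral_mono fun w => ?_) hint'.lintegral_lt_top
  refine ENNReal.ofReal_le_ofReal ?_
  rcases le_or_gt ‖w‖ δ with h | h
  · rw [cutoff_of_le hδ h, zero_div]
    positivity
  · rw [cutoff_of_lt hδ h, Real.rpow_neg (by positivity)]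
    have h0 : 0 < ‖w‖ := hδ.trans h
    have h1 : 1 + ‖w‖ ≤ (1 + 1 / δ) * ‖w‖ := by
      have : 1 ≤ 1 / δ * ‖w‖ := by
        rw [one_div, inv_mul_eq_div, one_le_div hδ]; exact h.le
      linarith
    have h2 : (1 + ‖w‖) ^ (3:ℝ) = (1 + ‖w‖) ^ 3 := by norm_cast
    rw [h2, ← div_eq_mul_inv, div_le_div_iff₀ (by positivity) (by positivity), one_mul, ← mul_pow]
    exact pow_le_pow_left₀ (by positivity) h1 3

lemma interaction_le (δ : ℝ) (A B : Set Plane) :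
    interaction δ A B ≤ (∫⁻ w, kernel δ w) * volume A := by
  calc interaction δ A B ≤ ∫⁻ _ in A, ∫⁻ w, kernel δ w := by
        refine lintegral_mono fun x => (setLIntegral_le_lintegral _ _).trans ?_
        rw [lintegral_sub_right_eq_self]
    _ = _ := by simp

/-- The interaction is symmetric, so finite area of either factor is enough. -/
lemma nonlocalTerm_lt_top {δ : ℝ} (hδ : 0 < δ) {Ω : Set Plane} (hΩ : MeasurableSet Ω)
    (h : volume Ω < ⊤ ∨ volume Ωᶜ < ⊤) : nonlocalTerm δ Ω < ⊤ := by
  rw [nonlocalTerm_eq_interaction δ hΩ]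
  refine ENNReal.mul_lt_top (by simp) ?_
  rcases h with h | h
  · exact (interaction_le δ _ _).trans_lt (ENNReal.mul_lt_top (lintegral_kernel_lt_top hδ) h)
  · rw [interaction_comm]
    exact (interaction_le δ _ _).trans_lt (ENNReal.mul_lt_top (lintegral_kernel_lt_top hδ) h)

/-- Tonelli in the variable `z = y - x`; lower bounds on the interaction reduce to areas of overlaps
of translates. -/
lemma interaction_eq_lintegral (δ : ℝ) (A : Set Plane) {B : Set Plane}
    (hB : MeasurableSet B) :
    interaction δ A B = ∫⁻ z, kernel δ z * volume (A ∩ (· + z) ⁻¹' B) := by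
  have h1 : ∀ x, ∫⁻ y in B, kernel δ (y - x) =
      ∫⁻ z, kernel δ z * ((· + z) ⁻¹' B).indicator 1 x := by
    intro x
    rw [← lintegral_indicator hB, ← lintegral_add_left_eq_self _ x]
    refine lintegral_congr fun z => ?_
    by_cases h : x + z ∈ B <;> simp [h]
  unfold interaction
  simp only [h1]
  rw [lintegral_lintegral_swap]
  · refine lintegral_congr fun z => ?_
    have hm : MeasurableSet ((· + z) ⁻¹' B) := (measurable_add_const z) hB
    rw [lintegral_const_mul _ (measurable_one.indicator hm), lintegral_indicator_one hm,
      Measure.restrict_apply hm, inter_comm]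
  · have hs : MeasurableSet {p : Plane × Plane | p.1 + p.2 ∈ B} :=
      (measurable_fst.add measurable_snd) hB
    have : Measurable fun p : Plane × Plane => kernel δ p.2 *
        {p : Plane × Plane | p.1 + p.2 ∈ B}.indicator 1 p :=
      ((measurable_kernel δ).comp measurable_snd).mul (measurable_one.indicator hs)
    exact this.aemeasurable

lemma interaction_preimage_add_right (δ : ℝ) (a : Plane) (A : Set Plane) {B : Set Plane}
    (hB : MeasurableSet B) :
    interaction δ ((· + a) ⁻¹' A) ((· + a) ⁻¹' B) = interaction δ A B := by
  rw [interaction_eq_lintegral δ A hB, interaction_eq_lintegral δ _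
    (measurable_add_const a hB)]
  refine lintegral_congr fun z => ?_
  congr 1
  rw [← measure_preimage_add_right volume a (A ∩ (· + z) ⁻¹' B)]
  congr 1
  ext x
  simp [add_right_comm]

lemma nonlocalTerm_ball (δ : ℝ) (a : Plane) (R : ℝ) :
    nonlocalTerm δ (Metric.ball a R) = nonlocalTerm δ (Metric.ball 0 R) := by
  have hpre : (· + a) ⁻¹' Metric.ball a R = Metric.ball (0 : Plane) R := by
    ext x; simp
  rw [nonlocalTerm_eq_interaction δ measurableSet_ball,
    nonlocalTerm_eq_interaction δ measurableSet_ball, ← hpre, ← preimage_compl,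
    interaction_preimage_add_right δ a _ measurableSet_ball.compl]

/-! ### Lower bound for the interaction of a disk with the surrounding annulus. -/

/-- The part of a disk that leaves the disk under a vertical translation. -/
lemma volume_ball_inter_translate_single_ge {R t : ℝ} (ht : 0 ≤ t) (htR : t ≤ 2 * R) :
    ENNReal.ofReal ((2 * R - t) * t) ≤ volume (Metric.ball (0 : Plane) R ∩
      (· + EuclideanSpace.single 1 t) ⁻¹' (Metric.ball (0 : Plane) R)ᶜ) := by
  have hm : MeasurableSet (Metric.ball (0 : Plane) R ∩
      (· + EuclideanSpace.single 1 t) ⁻¹' (Metric.ball (0 : Plane) R)ᶜ) :=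
    measurableSet_ball.inter (measurable_add_const _ measurableSet_ball.compl)
  rw [← measurePreserving_planeEquiv.symm.measure_preimage hm.nullMeasurableSet]
  -- On a vertical chord of half-length at least `t / 2`, the top segment of length `t` lies in the
  -- disk and leaves it when raised by `t`. All chords with `|y| < R - t / 2` are that long, and
  -- these segments sweep out area `(2R - t)t`.
  set f : ℝ → ℝ := fun y => Real.sqrt (R ^ 2 - y ^ 2) - t
  set g : ℝ → ℝ := fun y => Real.sqrt (R ^ 2 - y ^ 2)
  have hreg : volume (regionBetween f g (Ioo (-(R - t / 2)) (R - t / 2))) =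
      ENNReal.ofReal ((2 * R - t) * t) := by
    rw [Measure.volume_eq_prod, volume_regionBetween_eq_lintegral' (by fun_prop) (by fun_prop)
      measurableSet_Ioo]
    have : ∀ y, (g - f) y = t := fun y => by simp [f, g]
    simp only [this]
    rw [setLIntegral_const, Real.volume_Ioo, mul_comm, ← ENNReal.ofReal_mul (by linarith)]
    congr 1; ring
  rw [← hreg]
  refine measure_mono ?_
  rintro ⟨y, x⟩ ⟨⟨hy1, hy2⟩, hx1, hx2⟩
  simp only [f, g] at hx1 hx2 hy1 hy2
  have hy : t ^ 2 / 4 ≤ R ^ 2 - y ^ 2 := by nlinarith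
  have hs : t / 2 ≤ Real.sqrt (R ^ 2 - y ^ 2) := Real.le_sqrt_of_sq_le (by nlinarith)
  have hsq := Real.sq_sqrt (show 0 ≤ R ^ 2 - y ^ 2 by nlinarith)
  set s := Real.sqrt (R ^ 2 - y ^ 2)
  have hR : 0 ≤ R := by linarith
  have key : ∀ u v : ℝ, ‖(!₂[u, v] : Plane)‖ ^ 2 = u ^ 2 + v ^ 2 := fun u v => by
    simp [EuclideanSpace.norm_sq_eq, Fin.sum_univ_two]
  have hadd : (!₂[y, x] : Plane) + EuclideanSpace.single 1 t = !₂[y, x + t] := by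
    ext i; fin_cases i <;> simp
  have hRpos : 0 < R := by
    rcases hR.eq_or_lt with h | h
    · subst h; nlinarith
    · exact h
  simp only [mem_preimage, planeEquiv_symm_apply, mem_inter_iff, mem_ball_zero_iff, hadd,
    mem_compl_iff, not_lt]
  constructor
  · refine lt_of_pow_lt_pow_left₀ 2 hR ?_
    rw [key]; nlinarith
  · refine le_of_sq_le_sq ?_ (norm_nonneg _)
    rw [key]; nlinarith

/-- A reflection carries `z` to the vertical vector of the same length and preserves both area and
centered disks. -/
lemma volume_ball_inter_translate_ge (a : Plane) {R : ℝ} {z : Plane} (hz : ‖z‖ ≤ 2 * R) :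
    ENNReal.ofReal ((2 * R - ‖z‖) * ‖z‖) ≤
      volume (Metric.ball a R ∩ (· + z) ⁻¹' (Metric.ball a R)ᶜ) := by
  refine (volume_ball_inter_translate_single_ge (norm_nonneg z) hz).trans_eq ?_
  have hn : ‖z‖ = ‖(EuclideanSpace.single 1 ‖z‖ : Plane)‖ := by simp
  set w : Plane := EuclideanSpace.single 1 ‖z‖
  set ρ := (Submodule.span ℝ {z - w})ᗮ.reflection
  have hρ : ρ z = w := Submodule.reflection_sub hn
  have hm : MeasurableSet (Metric.ball (0 : Plane) R ∩
      (· + w) ⁻¹' (Metric.ball (0 : Plane) R)ᶜ) :=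
    measurableSet_ball.inter (measurable_add_const _ measurableSet_ball.compl)
  rw [← measure_preimage_add_right volume a (Metric.ball a R ∩ (· + z) ⁻¹' (Metric.ball a R)ᶜ),
    ← ρ.measurePreserving.measure_preimage hm.nullMeasurableSet]
  congr 1
  ext x
  simp only [mem_preimage, mem_inter_iff, mem_compl_iff, ← hρ, ← map_add, sub_zero,
    LinearIsometryEquiv.norm_map, mem_ball_iff_norm, add_sub_cancel_right, add_right_comm x a z]

/-- In polar coordinates the radial density is `2R/r - 1` on `(δ, R)`; its first term produces the
decisive logarithm. -/
lemma lintegral_annulus_profile {δ R : ℝ} (hδ : 0 < δ) (hR : δ < R) :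
    ∫⁻ z : Plane, ENNReal.ofReal
        ((Ioo δ R).indicator (fun r => (2 * R - r) * r / r ^ 3) ‖z‖) =
      ENNReal.ofReal (2 * Real.pi * (2 * R * Real.log (R / δ) - (R - δ))) := by
  set h : ℝ → ℝ := (Ioo δ R).indicator (fun r => (2 * R - r) * r / r ^ 3)
  have hh : ∀ r, 0 ≤ h r := fun r => indicator_nonneg (fun s hs => by
    have h1 : 0 < s := hδ.trans hs.1
    have h2 : 0 ≤ 2 * R - s := by linarith [hs.2]
    positivity) r
  have hmul : ∀ y : ℝ, y ^ (Module.finrank ℝ Plane - 1) • h y =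
      (Ioo δ R).indicator (fun r => 2 * R * r⁻¹ - 1) y := by
    intro y
    by_cases hy : y ∈ Ioo δ R
    · have : 0 < y := hδ.trans hy.1
      simp only [h, indicator_of_mem hy, finrank_euclideanSpace, Fintype.card_fin, smul_eq_mul,
        Nat.add_one_sub_one, pow_one]
      field_simp
    · simp only [h, indicator_of_notMem hy, smul_zero]
  have hcont : ContinuousOn (fun r : ℝ => 2 * R * r⁻¹ - 1) (Icc δ R) := by
    refine ((continuousOn_const.mul (continuousOn_inv₀.mono ?_)).sub continuousOn_const)
    intro y hy
    exact (hδ.trans_le hy.1).ne'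
  have hint : Integrable (fun z : Plane => h ‖z‖) := by
    rw [integrable_fun_norm_addHaar]
    simp only [hmul]
    refine (IntegrableOn.integrable_indicator ?_ measurableSet_Ioo).integrableOn
    exact (hcont.integrableOn_compact isCompact_Icc).mono_set Ioo_subset_Icc_self
  rw [← ofReal_integral_eq_lintegral_ofReal hint (Filter.Eventually.of_forall fun z => hh _),
    integral_fun_norm_addHaar]
  simp only [hmul]
  congr 1
  rw [setIntegral_indicator measurableSet_Ioo,
    inter_eq_right.2 (Ioo_subset_Ioi_self.trans (Ioi_subset_Ioi hδ.le)),
    ← integral_Ioc_eq_integral_Ioo, ← intervalIntegral.integral_of_le hR.le,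
    intervalIntegral.integral_sub, intervalIntegral.integral_const_mul,
    integral_inv_of_pos hδ (hδ.trans hR)]
  · simp [Measure.real, EuclideanSpace.volume_ball_fin_two, Real.pi_pos.le]
    ring
  · refine (ContinuousOn.intervalIntegrable ?_).const_mul _
    refine continuousOn_inv₀.mono fun y hy => ?_
    rw [uIcc_of_le hR.le] at hy
    exact (hδ.trans_le hy.1).ne'
  · simp

/-- The interaction of a disk with the surrounding annulus. -/
lemma interaction_ball_annulus_ge {δ R : ℝ} (hδ : 0 < δ) (hR : δ < R) (a : Plane) :
    ENNReal.ofReal (2 * Real.pi * (2 * R * Real.log (R / δ) - (R - δ))) ≤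
      interaction δ (Metric.ball a R) (Metric.ball a (2 * R) \ Metric.ball a R) := by
  rw [← lintegral_annulus_profile hδ hR, interaction_eq_lintegral δ _
    (measurableSet_ball.diff measurableSet_ball)]
  refine lintegral_mono fun z => ?_
  by_cases hz : ‖z‖ ∈ Ioo δ R
  -- A displacement shorter than `R` cannot leave the disk of radius `2R`, so the annulus acts as
  -- the full complement.
  · have hset : Metric.ball a R ∩ (· + z) ⁻¹' (Metric.ball a (2 * R) \ Metric.ball a R) =
        Metric.ball a R ∩ (· + z) ⁻¹' (Metric.ball a R)ᶜ := by
      ext x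
      simp only [mem_inter_iff, mem_preimage, mem_sdiff, mem_compl_iff, mem_ball_iff_norm]
      refine ⟨fun h => ⟨h.1, h.2.2⟩, fun h => ⟨h.1, ?_, h.2⟩⟩
      have := norm_add_le (x - a) z
      rw [show x + z - a = x - a + z by abel]
      linarith [h.1, hz.2]
    have h0 : 0 < ‖z‖ := hδ.trans hz.1
    rw [hset, indicator_of_mem hz, kernel, cutoff_of_lt hδ hz.1, mul_div_assoc,
      mul_div_assoc', div_eq_mul_one_div, mul_comm ((2 * R - ‖z‖) * ‖z‖),
      ENNReal.ofReal_mul (by positivity)]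
    gcongr
    exact volume_ball_inter_translate_ge a (by linarith [hz.2])
  · rw [indicator_of_notMem hz]
    simp

end Dipolar

namespace Dipolar

open scoped ENNReal Topology Convolution
open Filter

/-! ### Approximation, duality and the effect of translations on sets of finite perimeter. -/

/-- A bounded measurable function supported in a ball is an almost everywhere limit of `C¹`
functions with the same bound and supported in a common larger ball. -/
lemma exists_contDiff_tendsto_ae {s : Plane → ℝ} (hs : Measurable s) (hb : ∀ x, |s x| ≤ 1)
    {ρ : ℝ} (hsupp : Function.support s ⊆ Metric.ball 0 ρ) :
    ∃ ψ : ℕ → Plane → ℝ, (∀ k, ContDiff ℝ 1 (ψ k)) ∧ (∀ k x, |ψ k x| ≤ 1) ∧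
      (∀ k, Function.support (ψ k) ⊆ Metric.closedBall 0 (ρ + 1)) ∧
      ∀ᵐ x, Tendsto (fun k => ψ k x) atTop (𝓝 (s x)) := by
  have hloc : LocallyIntegrable s volume :=
    (locallyIntegrable_const (1 : ℝ)).mono hs.aestronglyMeasurable
      (Eventually.of_forall fun x => by simpa using hb x)
  -- The ratio of outer to inner radius is fixed at `2`, as the almost everywhere convergence of the
  -- mollifications requires a bounded ratio.
  let b : ℕ → ContDiffBump (0 : Plane) := fun k =>
    { rIn := 1 / ((k : ℝ) + 1) / 2
      rOut := 1 / ((k : ℝ) + 1)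
      rIn_pos := by positivity
      rIn_lt_rOut := half_lt_self (by positivity) }
  have hout : ∀ k, (b k).rOut ≤ 1 := fun k =>
    div_le_one_of_le₀ (by linarith [k.cast_nonneg (α := ℝ)]) (by positivity)
  refine ⟨fun k => (b k).normed volume ⋆[ContinuousLinearMap.lsmul ℝ ℝ, volume] s,
    fun k => ?_, fun k x => ?_, fun k => ?_, ?_⟩
  · exact (b k).hasCompactSupport_normed.contDiff_convolution_left (n := 1) _
      (b k).contDiff_normed hloc
  · have := dist_convolution_le (x₀ := x) (z₀ := (0:ℝ)) zero_le_one
      ((b k).support_normed_eq (μ := volume)).subset (b k).nonneg_normed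
      (b k).integral_normed hs.aestronglyMeasurable (fun y _ => by simpa using hb y)
    simpa using this
  · refine (support_convolution_subset _).trans ?_
    rw [(b k).support_normed_eq]
    rintro _ ⟨y, hy, z, hz, rfl⟩
    have h1 := hsupp hz
    rw [mem_ball_zero_iff] at hy h1
    rw [mem_closedBall_zero_iff]
    linarith [norm_add_le y z, hout k]
  · refine ContDiffBump.ae_convolution_tendsto_right_of_locallyIntegrable (K := 2)
      tendsto_one_div_add_atTop_nhds_zero_nat (Eventually.of_forall fun k => ?_) hloc
    simp only [b]
    linarith

/-- The `L¹` norm of a bounded function is computed by testing with `C¹` functions. -/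
lemma lintegral_enorm_le_of_forall_test {g : Plane → ℝ} (hg : Measurable g) (hb : ∀ x, |g x| ≤ 1)
    {M : ℝ} (h : ∀ ψ : Plane → ℝ, ContDiff ℝ 1 ψ → HasCompactSupport ψ → (∀ x, |ψ x| ≤ 1) →
      ∫ x, g x * ψ x ≤ M) :
    ∫⁻ x, ‖g x‖ₑ ≤ ENNReal.ofReal M := by
  have hball : ∀ n : ℕ, ∫⁻ x in Metric.ball (0 : Plane) n, ‖g x‖ₑ ≤ ENNReal.ofReal M := by
    intro n
    -- The optimal test function would be the sign of `g`; it is truncated to a ball and then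
    -- mollified.
    set s : Plane → ℝ := (Metric.ball (0 : Plane) n).indicator fun x => SignType.sign (g x)
    have hsgn : Measurable fun x => ((SignType.sign (g x) : SignType) : ℝ) := by
      have : (fun x => ((SignType.sign (g x) : SignType) : ℝ)) =
          fun x => (Ioi (0:ℝ)).indicator 1 (g x) - (Iio (0:ℝ)).indicator 1 (g x) := by
        ext x
        rcases lt_trichotomy (g x) 0 with h | h | h
        · simp [h, h.le]
        · simp [h]
        · simp [h, h.le]
      rw [this]
      exact ((measurable_one.indicator measurableSet_Ioi).comp hg).sub
        ((measurable_one.indicator measurableSet_Iio).comp hg)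
    have hs : Measurable s := hsgn.indicator measurableSet_ball
    have hsb : ∀ x, |s x| ≤ 1 := by
      intro x
      by_cases hx : x ∈ Metric.ball (0 : Plane) n
      · simp only [s, indicator_of_mem hx]
        rcases lt_trichotomy (g x) 0 with h | h | h <;> simp [h]
      · simp [s, indicator_of_notMem hx]
    obtain ⟨ψ, hψ1, hψ2, hψ3, hψ4⟩ := exists_contDiff_tendsto_ae hs hsb support_indicator_subset
    have hlim : Tendsto (fun k => ∫ x, g x * ψ k x) atTop (𝓝 (∫ x, g x * s x)) := by
      refine tendsto_integral_of_dominated_convergence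
        ((Metric.closedBall (0 : Plane) (n + 1)).indicator 1) (fun k => ?_) ?_ (fun k => ?_) ?_
      · exact (hg.mul (hψ1 k).continuous.measurable).aestronglyMeasurable
      · exact (integrableOn_const (C := (1:ℝ)) measure_closedBall_lt_top.ne).integrable_indicator
          measurableSet_closedBall
      · refine Eventually.of_forall fun x => ?_
        by_cases hx : x ∈ Metric.closedBall (0 : Plane) (n + 1)
        · rw [indicator_of_mem hx, norm_mul]
          exact mul_le_one₀ (hb x) (norm_nonneg _) (hψ2 k x)
        · have : ψ k x = 0 := by
            by_contra h0
            exact hx (hψ3 k h0)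
          simp [this, indicator_of_notMem hx]
      · filter_upwards [hψ4] with x hx
        exact hx.const_mul _
    have hle : ∫ x, g x * s x ≤ M := by
      refine le_of_tendsto' hlim fun k => h _ (hψ1 k) ?_ (hψ2 k)
      exact HasCompactSupport.of_support_subset_isCompact (isCompact_closedBall _ _) (hψ3 k)
    have heq : ∫ x, g x * s x = ∫ x in Metric.ball (0 : Plane) n, ‖g x‖ := by
      rw [← integral_indicator measurableSet_ball]
      refine integral_congr_ae (Eventually.of_forall fun x => ?_)
      by_cases hx : x ∈ Metric.ball (0 : Plane) n
      · simp only [s, indicator_of_mem hx, Real.norm_eq_abs, mul_comm (g x), sign_mul_self]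
      · simp [s, indicator_of_notMem hx]
    have hint : IntegrableOn g (Metric.ball (0 : Plane) n) :=
      Measure.integrableOn_of_bounded measure_ball_lt_top.ne hg.aestronglyMeasurable
        (Eventually.of_forall hb)
    rw [← ofReal_integral_norm_eq_lintegral_enorm hint, ← heq]
    exact ENNReal.ofReal_le_ofReal hle
  have hcover : AECover volume atTop fun n : ℕ => Metric.ball (0 : Plane) n :=
    aecover_ball tendsto_natCast_atTop_atTop
  exact le_of_tendsto' (hcover.lintegral_tendsto_of_nat hg.enorm.aemeasurable) hball

lemma divergence_smul_single {c : Plane → ℝ} (hc : Differentiable ℝ c) (i : Fin 2) (x : Plane) :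
    divergence (fun y => c y • EuclideanSpace.single i (1:ℝ)) x =
      fderiv ℝ c x (EuclideanSpace.single i 1) := by
  have h := (hc x).hasFDerivAt.smul_const (EuclideanSpace.single i (1:ℝ) : Plane)
  rw [divergence, h.fderiv]
  simp [PiLp.single_apply]

lemma isTestField_smul_single {c : Plane → ℝ} (h1 : ContDiff ℝ 1 c) (h2 : HasCompactSupport c)
    (h3 : ∀ x, |c x| ≤ 1) (i : Fin 2) :
    IsTestField fun y => c y • (EuclideanSpace.single i (1:ℝ) : Plane) :=
  ⟨h1.smul contDiff_const, h2.smul_right, fun x => by simpa [norm_smul] using h3 x⟩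

lemma hasDerivAt_setIntegral_translate {c : Plane → ℝ} (h1 : ContDiff ℝ 1 c)
    (h2 : HasCompactSupport c) (Ω : Set Plane) (e : Plane) (t₀ : ℝ) :
    HasDerivAt (fun t : ℝ => ∫ x in Ω, c (x + t • e))
      (∫ x in Ω, fderiv ℝ c (x + t₀ • e) e) t₀ := by
  obtain ⟨K, hK⟩ := (h1.continuous_fderiv one_ne_zero).bounded_above_of_compact_support
    (h2.fderiv (𝕜 := ℝ))
  obtain ⟨ρ, hρ⟩ := h2.isCompact.isBounded.subset_closedBall 0
  have hcont : ∀ t : ℝ, Continuous fun x : Plane => c (x + t • e) := fun t =>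
    h1.continuous.comp (by fun_prop)
  have hfc := h1.continuous_fderiv one_ne_zero
  refine (hasDerivAt_integral_of_dominated_loc_of_deriv_le (s := Metric.ball t₀ 1)
    (F := fun t x => c (x + t • e)) (F' := fun t x => fderiv ℝ c (x + t • e) e)
    (bound := (Metric.closedBall (0 : Plane) (ρ + (|t₀| + 1) * ‖e‖)).indicator
      fun _ => K * ‖e‖) (Metric.ball_mem_nhds _ one_pos) ?_ ?_ ?_ ?_ ?_ ?_).2
  · exact Eventually.of_forall fun t => (hcont t).aestronglyMeasurable
  · exact ((hcont t₀).integrable_of_hasCompactSupport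
      (h2.comp_homeomorph (Homeomorph.addRight (t₀ • e)))).integrableOn
  · exact Continuous.aestronglyMeasurable (by fun_prop)
  · refine Eventually.of_forall fun x t ht => ?_
    by_cases hx : x ∈ Metric.closedBall (0 : Plane) (ρ + (|t₀| + 1) * ‖e‖)
    · rw [indicator_of_mem hx]
      exact (ContinuousLinearMap.le_opNorm _ _).trans
        (mul_le_mul_of_nonneg_right (hK _) (norm_nonneg _))
    · rw [indicator_of_notMem hx]
      have hnot : x + t • e ∉ tsupport c := by
        intro hmem
        have h3 := hρ hmem
        rw [mem_closedBall_zero_iff] at h3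
        refine hx (mem_closedBall_zero_iff.2 ?_)
        have h4 : ‖x‖ ≤ ‖x + t • e‖ + ‖t • e‖ := by
          simpa using norm_sub_le (x + t • e) (t • e)
        rw [norm_smul, Real.norm_eq_abs] at h4
        have h5 : |t| ≤ |t₀| + 1 := by
          rw [Metric.mem_ball, Real.dist_eq] at ht
          linarith [abs_sub_abs_le_abs_sub t t₀]
        nlinarith [norm_nonneg e]
      rw [fderiv_of_notMem_tsupport ℝ hnot]
      simp
  · exact ((integrableOn_const (C := K * ‖e‖) measure_closedBall_lt_top.ne).integrable_indicator
      measurableSet_closedBall).integrableOn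
  · refine Eventually.of_forall fun x t _ => ?_
    have h3 : HasDerivAt (fun t : ℝ => x + t • e) e t := by
      simpa using ((hasDerivAt_id t).smul_const e).const_add x
    exact ((h1.differentiable one_ne_zero _).hasFDerivAt).comp_hasDerivAt t h3

lemma measurable_chi {Ω : Set Plane} (hΩ : MeasurableSet Ω) : Measurable (chi Ω) :=
  measurable_one.indicator hΩ

lemma integral_chi_mul {Ω : Set Plane} (hΩ : MeasurableSet Ω) (ψ : Plane → ℝ) :
    ∫ x, chi Ω x * ψ x = ∫ x in Ω, ψ x := by
  rw [← integral_indicator hΩ]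
  refine integral_congr_ae (Eventually.of_forall fun x => ?_)
  by_cases hx : x ∈ Ω <;> simp [chi, hx]

/-- Translations along a coordinate axis change the characteristic function of a set of finite
perimeter by at most the length of the translation times the perimeter. -/
lemma lintegral_enorm_translate_sub_le {Ω : Set Plane} (hΩ : MeasurableSet Ω)
    (hP : perimeter Ω < ⊤) (i : Fin 2) {h : ℝ} (hh : 0 ≤ h) :
    ∫⁻ x, ‖chi Ω (x + h • EuclideanSpace.single i (1:ℝ)) - chi Ω x‖ₑ ≤
      ENNReal.ofReal h * perimeter Ω := by
  set e : Plane := EuclideanSpace.single i (1:ℝ)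
  have hm := measurable_chi hΩ
  have hm' : Measurable fun x => chi Ω (x + h • e) := hm.comp (measurable_add_const _)
  have h01 : ∀ x, chi Ω x = 0 ∨ chi Ω x = 1 := fun x => by
    by_cases hx : x ∈ Ω <;> simp [chi, hx]
  rw [← ENNReal.ofReal_toReal hP.ne, ← ENNReal.ofReal_mul hh]
  refine lintegral_enorm_le_of_forall_test (hm'.sub hm) (fun x => ?_) fun ψ h1 h2 h3 => ?_
  · rcases h01 x with h0 | h0 <;> rcases h01 (x + h • e) with h' | h' <;> simp [h0, h']
  have hi : Integrable ψ := h1.continuous.integrable_of_hasCompactSupport h2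
  have hi1 : Integrable fun x => chi Ω x * ψ x :=
    hi.bdd_mul hm.aestronglyMeasurable (c := 1)
      (Eventually.of_forall fun x => by rcases h01 x with h | h <;> simp [h])
  have hi2 : Integrable fun x => chi Ω (x + h • e) * ψ x :=
    hi.bdd_mul hm'.aestronglyMeasurable (c := 1)
      (Eventually.of_forall fun x => by rcases h01 (x + h • e) with h | h <;> simp [h])
  set c : Plane → ℝ := fun x => -ψ x with hc
  have hc1 : ContDiff ℝ 1 c := h1.neg
  have hc2 : HasCompactSupport c := h2.neg
  -- The tested difference is `F 0 - F (-h)`, and `F' t` is the flux through `Ω` of the admissible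
  -- field `c(· + t e) e`, hence at most the perimeter. The mean value inequality concludes.
  set F : ℝ → ℝ := fun t => ∫ x in Ω, c (x + t • e)
  have hF : ∀ t, HasDerivAt F (∫ x in Ω, fderiv ℝ c (x + t • e) e) t :=
    hasDerivAt_setIntegral_translate hc1 hc2 Ω e
  have hshift : ∫ x, chi Ω (x + h • e) * ψ x = ∫ x in Ω, ψ (x + (-h) • e) := by
    rw [← integral_chi_mul hΩ,
      ← integral_add_right_eq_self (fun x => chi Ω x * ψ (x + (-h) • e)) (h • e)]
    simp
  have hkey : ∫ x, (chi Ω (x + h • e) - chi Ω x) * ψ x = F 0 - F (-h) := by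
    simp only [sub_mul]
    rw [integral_sub hi2 hi1, hshift, integral_chi_mul hΩ]
    simp only [F, hc, integral_neg, zero_smul, add_zero]
    ring
  have hder : ∀ t, deriv F t ≤ (perimeter Ω).toReal := by
    intro t
    rw [(hF t).deriv]
    have ht : IsTestField fun y => c (y + t • e) • (EuclideanSpace.single i (1:ℝ) : Plane) :=
      isTestField_smul_single (hc1.comp (contDiff_id.add contDiff_const))
        (hc2.comp_homeomorph (Homeomorph.addRight (t • e))) (fun x => by simpa [hc] using h3 _) i
    have hle := le_perimeter ht Ω
    have hd : ∀ x, divergence (fun y => c (y + t • e) • (EuclideanSpace.single i (1:ℝ) : Plane)) x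
        = fderiv ℝ c (x + t • e) e := by
      intro x
      rw [divergence_smul_single (c := fun y => c (y + t • e))
        ((hc1.differentiable one_ne_zero).comp (differentiable_id.add_const _)),
        fderiv_comp_add_right]
    simp only [hd] at hle
    exact (ENNReal.ofReal_le_iff_le_toReal hP.ne).1 hle
  have := image_sub_le_mul_sub_of_deriv_le (fun t => (hF t).differentiableAt) hder
    (show -h ≤ 0 by linarith)
  calc _ = F 0 - F (-h) := hkey
    _ ≤ _ := by linarith

/-! ### Slicing: finite perimeter forces finite area of the set or of its complement. -/

/-- A set of reals that is neither null nor conull has total variation at least one. -/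
lemma one_le_liminf_variation {S : Set ℝ} (hS : MeasurableSet S) (h1 : volume S ≠ 0)
    (h0 : volume Sᶜ ≠ 0) :
    1 ≤ liminf (fun n : ℕ => ENNReal.ofReal ((n : ℝ) + 1) *
      ∫⁻ x, ‖S.indicator (1 : ℝ → ℝ) (x + 1 / ((n : ℝ) + 1)) - S.indicator 1 x‖ₑ) atTop := by
  set u : ℝ → ℝ := S.indicator 1
  have hu : Measurable u := measurable_one.indicator hS
  have hloc : LocallyIntegrable u volume :=
    (locallyIntegrable_const (1 : ℝ)).mono hu.aestronglyMeasurable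
      (Eventually.of_forall fun x => by by_cases h : x ∈ S <;> simp [u, h])
  have hii : ∀ a b, IntervalIntegrable u volume a b := fun a b =>
    (hloc.integrableOn_isCompact isCompact_uIcc).intervalIntegrable
  have hae := LocallyIntegrable.ae_hasDerivAt_integral hloc
  -- Neither `S` nor its complement is null, so each contains a point where the primitive of `u` has
  -- derivative `u`. The difference quotients tend to `1` at `p` and to `0` at `q`.
  obtain ⟨p, hpS, hp⟩ : ∃ p ∈ S, ∀ c, HasDerivAt (fun x => ∫ t in c..x, u t) (u p) p := by
    by_contra! hcon
    refine h1 (measure_mono_null (fun p hp => ?_) (ae_iff.1 hae))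
    obtain ⟨c, hc⟩ := hcon p hp
    exact fun hall => hc (hall c)
  obtain ⟨q, hqS, hq⟩ : ∃ q ∈ Sᶜ, ∀ c, HasDerivAt (fun x => ∫ t in c..x, u t) (u q) q := by
    by_contra! hcon
    refine h0 (measure_mono_null (fun p hp => ?_) (ae_iff.1 hae))
    obtain ⟨c, hc⟩ := hcon p hp
    exact fun hall => hc (hall c)
  set F : ℝ → ℝ := fun x => ∫ t in (0:ℝ)..x, u t
  have hup : u p = 1 := by simp [u, hpS]
  have huq : u q = 0 := indicator_of_notMem hqS _
  have hlim : ∀ y, HasDerivAt F (u y) y → Tendsto (fun n : ℕ => ((n : ℝ) + 1) *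
      (F (y + 1 / ((n : ℝ) + 1)) - F y)) atTop (𝓝 (u y)) := by
    intro y hy
    have h2 := hy.tendsto_slope_zero_right.comp
      (tendsto_nhdsWithin_iff.2 ⟨tendsto_one_div_add_atTop_nhds_zero_nat (𝕜 := ℝ),
        Eventually.of_forall fun n => mem_Ioi.2 (by positivity)⟩)
    refine h2.congr fun n => ?_
    simp
  have hdiff := ((hlim p (hp 0)).sub (hlim q (hq 0))).abs
  rw [hup, huq, sub_zero, abs_one] at hdiff
  have hE := ENNReal.tendsto_ofReal hdiff
  rw [ENNReal.ofReal_one] at hE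
  rw [← hE.liminf_eq]
  refine liminf_le_liminf (Eventually.of_forall fun n => ?_)
  set h : ℝ := 1 / ((n : ℝ) + 1)
  have hn : (0:ℝ) ≤ (n : ℝ) + 1 := by positivity
  rw [← mul_sub, abs_mul, abs_of_nonneg hn, ENNReal.ofReal_mul hn]
  gcongr
  have hshift : IntervalIntegrable (fun x => u (x + h)) volume q p := by
    simpa using (hii (q + h) (p + h)).comp_add_right h
  -- The gap between the two difference quotients is thus controlled by the `L¹` norm of the
  -- translation difference.
  have heq : F (p + h) - F p - (F (q + h) - F q) = ∫ x in q..p, (u (x + h) - u x) := by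
    rw [intervalIntegral.integral_sub hshift (hii _ _),
      intervalIntegral.integral_comp_add_right (f := u)]
    have e1 := intervalIntegral.integral_interval_sub_left (hii 0 (p + h)) (hii 0 (q + h))
    have e2 := intervalIntegral.integral_interval_sub_left (hii 0 p) (hii 0 q)
    simp only [F]
    linarith
  rw [heq, ← Real.enorm_eq_ofReal_abs]
  calc ‖∫ x in q..p, (u (x + h) - u x)‖ₑ
      = ‖∫ x in uIoc q p, (u (x + h) - u x)‖ₑ := by
        rw [← ofReal_norm, ← ofReal_norm, intervalIntegral.norm_intervalIntegral_eq]
    _ ≤ ∫⁻ x in uIoc q p, ‖u (x + h) - u x‖ₑ := enorm_integral_le_lintegral_enorm _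
    _ ≤ _ := setLIntegral_le_lintegral _ _

/-- The set of lines on which a planar set is neither null nor conull has measure at most the
variation of the set in the direction of these lines. -/
lemma volume_nontrivial_slices_le {S : Set (ℝ × ℝ)} (hS : MeasurableSet S) {P : ℝ≥0∞}
    (h : ∀ t : ℝ, 0 ≤ t → ∫⁻ y, ∫⁻ x, ‖S.indicator (1 : ℝ × ℝ → ℝ) (y, x + t) -
      S.indicator 1 (y, x)‖ₑ ≤ ENNReal.ofReal t * P) :
    volume {y : ℝ | volume (Prod.mk y ⁻¹' S) ≠ 0 ∧ volume (Prod.mk y ⁻¹' S)ᶜ ≠ 0} ≤ P := by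
  have hu : Measurable (S.indicator (1 : ℝ × ℝ → ℝ)) := measurable_one.indicator hS
  set V : ℕ → ℝ → ℝ≥0∞ := fun n y => ENNReal.ofReal ((n : ℝ) + 1) *
    ∫⁻ x, ‖S.indicator (1 : ℝ × ℝ → ℝ) (y, x + 1 / ((n : ℝ) + 1)) - S.indicator 1 (y, x)‖ₑ
  have hV : ∀ n, Measurable (V n) := by
    intro n
    refine Measurable.const_mul (Measurable.lintegral_prod_right' (f := fun q : ℝ × ℝ =>
      ‖S.indicator (1 : ℝ × ℝ → ℝ) (q.1, q.2 + 1 / ((n : ℝ) + 1)) - S.indicator 1 (q.1, q.2)‖ₑ)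
      ?_) _
    exact ((hu.comp (by fun_prop)).sub (hu.comp (by fun_prop))).enorm
  have hVP : ∀ n, ∫⁻ y, V n y ≤ P := by
    intro n
    have hn : (0:ℝ) < (n : ℝ) + 1 := by positivity
    simp only [V]
    rw [lintegral_const_mul' _ _ ENNReal.ofReal_ne_top]
    calc _ ≤ ENNReal.ofReal ((n : ℝ) + 1) * (ENNReal.ofReal (1 / ((n : ℝ) + 1)) * P) := by
          gcongr
          exact h _ (by positivity)
      _ = P := by
        rw [← mul_assoc, ← ENNReal.ofReal_mul hn.le, mul_one_div_cancel hn.ne',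
          ENNReal.ofReal_one, one_mul]
  have hsub : {y : ℝ | volume (Prod.mk y ⁻¹' S) ≠ 0 ∧ volume (Prod.mk y ⁻¹' S)ᶜ ≠ 0} ⊆
      {y : ℝ | 1 ≤ liminf (fun n => V n y) atTop} := by
    intro y hy
    have hslice : ∀ x, S.indicator (1 : ℝ × ℝ → ℝ) (y, x) =
        (Prod.mk y ⁻¹' S).indicator (1 : ℝ → ℝ) x := fun _ => rfl
    have h1 := one_le_liminf_variation (measurable_prodMk_left hS) hy.1 hy.2
    simp only [← hslice] at h1
    exact h1
  -- Markov's inequality, followed by Fatou's lemma.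
  calc volume {y : ℝ | volume (Prod.mk y ⁻¹' S) ≠ 0 ∧ volume (Prod.mk y ⁻¹' S)ᶜ ≠ 0}
      ≤ volume {y : ℝ | 1 ≤ liminf (fun n => V n y) atTop} :=
        measure_mono hsub
    _ ≤ ∫⁻ y, liminf (fun n => V n y) atTop := by
        simpa using mul_meas_ge_le_lintegral (Measurable.liminf hV) 1
    _ ≤ liminf (fun n => ∫⁻ y, V n y) atTop := lintegral_liminf_le hV
    _ ≤ P := by
        refine (liminf_le_liminf (Eventually.of_forall hVP)).trans_eq ?_
        exact liminf_const P

lemma volume_inter_fst_preimage_eq_zero {S : Set (ℝ × ℝ)} (hS : MeasurableSet S) {X : Set ℝ}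
    (h : ∀ x ∈ X, volume (Prod.mk x ⁻¹' S) = 0) : volume (S ∩ Prod.fst ⁻¹' X) = 0 := by
  -- `X` itself need not be measurable; the set of all null slices is.
  set X' : Set ℝ := {x | volume (Prod.mk x ⁻¹' S) = 0}
  have hX' : MeasurableSet X' :=
    (measurable_measure_prodMk_left hS) (measurableSet_singleton 0)
  refine measure_mono_null (inter_subset_inter_right S (preimage_mono (show X ⊆ X' from h))) ?_
  rw [Measure.volume_eq_prod, Measure.prod_apply (hS.inter (measurable_fst hX')),
    lintegral_eq_zero_iff (measurable_measure_prodMk_left (hS.inter (measurable_fst hX')))]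
  refine Eventually.of_forall fun x => ?_
  by_cases hx : x ∈ X'
  · exact measure_mono_null (fun y hy => hy.1) hx
  · refine measure_mono_null (t := ∅) (fun y hy => hx hy.2) measure_empty

lemma volume_inter_snd_preimage_eq_zero {S : Set (ℝ × ℝ)} (hS : MeasurableSet S) {Y : Set ℝ}
    (h : ∀ y ∈ Y, volume (Prod.mk y ⁻¹' (Prod.swap ⁻¹' S)) = 0) :
    volume (S ∩ Prod.snd ⁻¹' Y) = 0 := by
  have h1 := volume_inter_fst_preimage_eq_zero (measurable_swap hS) h
  have hmp : MeasurePreserving (MeasurableEquiv.prodComm : ℝ × ℝ ≃ᵐ ℝ × ℝ) volume volume :=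
    Measure.measurePreserving_swap
  rw [← hmp.measure_preimage_equiv]
  exact h1

/-- If almost every line parallel to the axes, up to a set of lines of finite measure, meets a
planar set in a null or conull set, then the set or its complement has finite area. -/
lemma volume_lt_top_or_compl_of_slices {S : Set (ℝ × ℝ)} (hS : MeasurableSet S)
    (hX : volume {x : ℝ | volume (Prod.mk x ⁻¹' S) ≠ 0 ∧ volume (Prod.mk x ⁻¹' S)ᶜ ≠ 0} < ⊤)
    (hY : volume {y : ℝ | volume (Prod.mk y ⁻¹' (Prod.swap ⁻¹' S)) ≠ 0 ∧
      volume (Prod.mk y ⁻¹' (Prod.swap ⁻¹' S))ᶜ ≠ 0} < ⊤) :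
    volume S < ⊤ ∨ volume Sᶜ < ⊤ := by
  set X := {x : ℝ | volume (Prod.mk x ⁻¹' S) ≠ 0 ∧ volume (Prod.mk x ⁻¹' S)ᶜ ≠ 0}
  set Y := {y : ℝ | volume (Prod.mk y ⁻¹' (Prod.swap ⁻¹' S)) ≠ 0 ∧
      volume (Prod.mk y ⁻¹' (Prod.swap ⁻¹' S))ᶜ ≠ 0}
  set X₀ := {x : ℝ | volume (Prod.mk x ⁻¹' S) = 0}
  set X₁ := {x : ℝ | volume (Prod.mk x ⁻¹' S)ᶜ = 0}
  set Y₀ := {y : ℝ | volume (Prod.mk y ⁻¹' (Prod.swap ⁻¹' S)) = 0}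
  set Y₁ := {y : ℝ | volume (Prod.mk y ⁻¹' (Prod.swap ⁻¹' S))ᶜ = 0}
  have cX : ∀ x, x ∈ X ∨ x ∈ X₀ ∨ x ∈ X₁ := fun x => by simp only [X, X₀, X₁, mem_ofPred_eq]; tauto
  have cY : ∀ x, x ∈ Y ∨ x ∈ Y₀ ∨ x ∈ Y₁ := fun x => by simp only [Y, Y₀, Y₁, mem_ofPred_eq]; tauto
  have nX₀ : volume (S ∩ Prod.fst ⁻¹' X₀) = 0 :=
    volume_inter_fst_preimage_eq_zero hS fun _ h => h
  have nX₁ : volume (Sᶜ ∩ Prod.fst ⁻¹' X₁) = 0 :=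
    volume_inter_fst_preimage_eq_zero hS.compl fun _ h => h
  have nY₀ : volume (S ∩ Prod.snd ⁻¹' Y₀) = 0 :=
    volume_inter_snd_preimage_eq_zero hS fun _ h => h
  have nY₁ : volume (Sᶜ ∩ Prod.snd ⁻¹' Y₁) = 0 :=
    volume_inter_snd_preimage_eq_zero hS.compl fun _ h => h
  have fst_null : ∀ A : Set ℝ, volume A = 0 → volume (Prod.fst ⁻¹' A : Set (ℝ × ℝ)) = 0 := by
    intro A hA
    rw [← prod_univ, Measure.volume_eq_prod, Measure.prod_prod, hA, zero_mul]
  have snd_null : ∀ A : Set ℝ, volume A = 0 → volume (Prod.snd ⁻¹' A : Set (ℝ × ℝ)) = 0 := by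
    intro A hA
    rw [← univ_prod, Measure.volume_eq_prod, Measure.prod_prod, hA, mul_zero]
  have hXY : volume (X ×ˢ Y) < ⊤ := by
    rw [Measure.volume_eq_prod, Measure.prod_prod]
    exact ENNReal.mul_lt_top hX hY
  -- The line has infinite measure, so in each direction the null slices and the conull slices
  -- cannot both be negligible.
  have big : ∀ {A A₀ A₁ : Set ℝ}, volume A < ⊤ → (∀ x, x ∈ A ∨ x ∈ A₀ ∨ x ∈ A₁) →
      volume A₀ = 0 → volume A₁ = 0 → False := by
    intro A A₀ A₁ hA hc h0 h1
    have : (univ : Set ℝ) ⊆ A ∪ (A₀ ∪ A₁) := fun x _ => hc x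
    have h2 := (measure_mono this).trans (measure_union_le (μ := volume) A (A₀ ∪ A₁))
    rw [measure_union_null h0 h1, add_zero, Real.volume_univ] at h2
    exact (h2.trans_lt hA).ne rfl
  -- On `X₀ ×ˢ Y₁` the set is null by one family of slices and conull by the other, so this
  -- rectangle is null.
  have prod01 : volume X₀ = 0 ∨ volume Y₁ = 0 := by
    rw [← mul_eq_zero, ← Measure.prod_prod, ← Measure.volume_eq_prod]
    refine measure_mono_null (fun q hq => ?_) (measure_union_null nX₀ nY₁)
    by_cases hqS : q ∈ S
    · exact Or.inl ⟨hqS, hq.1⟩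
    · exact Or.inr ⟨hqS, hq.2⟩
  have prod10 : volume X₁ = 0 ∨ volume Y₀ = 0 := by
    rw [← mul_eq_zero, ← Measure.prod_prod, ← Measure.volume_eq_prod]
    refine measure_mono_null (fun q hq => ?_) (measure_union_null nX₁ nY₀)
    by_cases hqS : q ∈ S
    · exact Or.inr ⟨hqS, hq.2⟩
    · exact Or.inl ⟨hqS, hq.1⟩
  have case0 : volume X₁ = 0 → volume Y₁ = 0 → volume S < ⊤ := by
    intro h1 h2
    have hsub : S ⊆ X ×ˢ Y ∪ ((S ∩ Prod.fst ⁻¹' X₀ ∪ Prod.fst ⁻¹' X₁) ∪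
        (S ∩ Prod.snd ⁻¹' Y₀ ∪ Prod.snd ⁻¹' Y₁)) := by
      intro q hq
      rcases cX q.1 with h | h | h
      · rcases cY q.2 with h' | h' | h'
        · exact Or.inl ⟨h, h'⟩
        · exact Or.inr (Or.inr (Or.inl ⟨hq, h'⟩))
        · exact Or.inr (Or.inr (Or.inr h'))
      · exact Or.inr (Or.inl (Or.inl ⟨hq, h⟩))
      · exact Or.inr (Or.inl (Or.inr h))
    refine (measure_mono hsub).trans_lt ((measure_union_le _ _).trans_lt ?_)
    rw [measure_union_null (measure_union_null nX₀ (fst_null _ h1))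
      (measure_union_null nY₀ (snd_null _ h2)), add_zero]
    exact hXY
  have case1 : volume X₀ = 0 → volume Y₀ = 0 → volume Sᶜ < ⊤ := by
    intro h1 h2
    have hsub : Sᶜ ⊆ X ×ˢ Y ∪ ((Sᶜ ∩ Prod.fst ⁻¹' X₁ ∪ Prod.fst ⁻¹' X₀) ∪
        (Sᶜ ∩ Prod.snd ⁻¹' Y₁ ∪ Prod.snd ⁻¹' Y₀)) := by
      intro q hq
      rcases cX q.1 with h | h | h
      · rcases cY q.2 with h' | h' | h'
        · exact Or.inl ⟨h, h'⟩
        · exact Or.inr (Or.inr (Or.inr h'))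
        · exact Or.inr (Or.inr (Or.inl ⟨hq, h'⟩))
      · exact Or.inr (Or.inl (Or.inr h))
      · exact Or.inr (Or.inl (Or.inl ⟨hq, h⟩))
    refine (measure_mono hsub).trans_lt ((measure_union_le _ _).trans_lt ?_)
    rw [measure_union_null (measure_union_null nX₁ (fst_null _ h1))
      (measure_union_null nY₁ (snd_null _ h2)), add_zero]
    exact hXY
  by_cases hx0 : volume X₀ = 0
  · have hx1 : volume X₁ ≠ 0 := fun h => big hX cX hx0 h
    exact Or.inr (case1 hx0 (prod10.resolve_left hx1))
  · have hy1 := prod01.resolve_left hx0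
    have hy0 : volume Y₀ ≠ 0 := fun h => big hY cY h hy1
    exact Or.inl (case0 (prod10.resolve_right hy0) hy1)

/-- A planar set of finite perimeter has finite area, or its complement has. -/
theorem volume_lt_top_or_compl_of_perimeter_lt_top {Ω : Set Plane} (hΩ : MeasurableSet Ω)
    (hP : perimeter Ω < ⊤) : volume Ω < ⊤ ∨ volume Ωᶜ < ⊤ := by
  set S : Set (ℝ × ℝ) := planeEquiv.symm ⁻¹' Ω
  have hS : MeasurableSet S := planeEquiv.symm.measurable hΩ
  have hmp := measurePreserving_planeEquiv.symm
  have hchi : ∀ q, chi Ω (planeEquiv.symm q) = S.indicator (1 : ℝ × ℝ → ℝ) q := fun q => rfl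
  have hu : Measurable (S.indicator (1 : ℝ × ℝ → ℝ)) := measurable_one.indicator hS
  have hX := volume_nontrivial_slices_le hS (P := perimeter Ω) fun t ht => by
    refine le_trans (le_of_eq ?_) (lintegral_enorm_translate_sub_le hΩ hP 1 ht)
    rw [← hmp.lintegral_comp_emb planeEquiv.symm.measurableEmbedding, Measure.volume_eq_prod,
      lintegral_prod]
    · refine lintegral_congr fun y => lintegral_congr fun x => ?_
      have : planeEquiv.symm (y, x) + t • (EuclideanSpace.single 1 (1:ℝ) : Plane) =
          planeEquiv.symm (y, x + t) := by
        simp only [planeEquiv_symm_apply]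
        ext j; fin_cases j <;> simp
      rw [this, hchi, hchi]
    · exact (((measurable_chi hΩ).comp ((measurable_add_const _).comp
        planeEquiv.symm.measurable)).sub
        ((measurable_chi hΩ).comp planeEquiv.symm.measurable)).enorm.aemeasurable
  have hY := volume_nontrivial_slices_le (measurable_swap hS) (P := perimeter Ω) fun t ht => by
    refine le_trans (le_of_eq ?_) (lintegral_enorm_translate_sub_le hΩ hP 0 ht)
    rw [← hmp.lintegral_comp_emb planeEquiv.symm.measurableEmbedding, Measure.volume_eq_prod,
      lintegral_prod_symm]
    · refine lintegral_congr fun y => lintegral_congr fun x => ?_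
      have : planeEquiv.symm (x, y) + t • (EuclideanSpace.single 0 (1:ℝ) : Plane) =
          planeEquiv.symm (x + t, y) := by
        simp only [planeEquiv_symm_apply]
        ext j; fin_cases j <;> simp
      rw [this, hchi, hchi]
      rfl
    · exact (((measurable_chi hΩ).comp ((measurable_add_const _).comp
        planeEquiv.symm.measurable)).sub
        ((measurable_chi hΩ).comp planeEquiv.symm.measurable)).enorm.aemeasurable
  have hres := volume_lt_top_or_compl_of_slices hS (hX.trans_lt hP) (hY.trans_lt hP)
  rwa [hmp.measure_preimage_equiv, ← preimage_compl, hmp.measure_preimage_equiv] at hres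

end Dipolar

namespace Dipolar

open scoped ENNReal
open Filter

/-! ### The energy gained by splitting off a disk. -/

lemma HasFinitePerimeter.nonlocalTerm_lt_top {δ : ℝ} (hδ : 0 < δ) {Ω : Set Plane}
    (h : HasFinitePerimeter Ω) : nonlocalTerm δ Ω < ⊤ := by
  obtain ⟨Ω', -, hm, hae⟩ := h.1.exists_measurable_superset_ae_eq
  rw [← nonlocalTerm_congr δ hae]
  refine Dipolar.nonlocalTerm_lt_top hδ hm (volume_lt_top_or_compl_of_perimeter_lt_top hm ?_)
  rw [perimeter_congr hae]
  exact h.2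

lemma hasFinitePerimeter_ball (a : Plane) {R : ℝ} (hR : 0 ≤ R) :
    HasFinitePerimeter (Metric.ball a R) :=
  ⟨measurableSet_ball.nullMeasurableSet, (perimeter_ball_le a hR).trans_lt ENNReal.ofReal_lt_top⟩

lemma HasFinitePerimeter.diff {Ω B : Set Plane} (hΩ : HasFinitePerimeter Ω)
    (hB : HasFinitePerimeter B) (hBm : MeasurableSet B) (hsub : B ≤ᵐ[volume] Ω) :
    HasFinitePerimeter (Ω \ B) :=
  ⟨hΩ.1.diff hB.1, (perimeter_diff_le hBm hsub).trans_lt (ENNReal.add_lt_top.2 ⟨hΩ.2, hB.2⟩)⟩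

lemma ContainsDisk.ball_ae_le {Ω : Set Plane} {a : Plane} {r s : ℝ} (h : ContainsDisk Ω a r)
    (hs : s ≤ r) : Metric.ball a s ≤ᵐ[volume] Ω := by
  rw [ae_le_set]
  exact measure_mono_null (sdiff_subset_sdiff_left (Metric.ball_subset_ball hs)) h

/-- Splitting off a disk from a set that contains the concentric disk of twice the radius. -/
lemma energy_split_ball_le {lam δ R : ℝ} (hlam : 0 ≤ lam) (hδ : 0 < δ) (hR : δ < R)
    {Ω : Set Plane} {a : Plane} (hΩ : HasFinitePerimeter Ω) (hd : ContainsDisk Ω a (2 * R)) :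
    energy lam δ (Ω \ Metric.ball a R) + energy lam δ (Metric.ball 0 R) ≤
      energy lam δ Ω + 4 * Real.pi * R - lam / |Real.log δ| *
        (2 * Real.pi * (2 * R * Real.log (R / δ) - (R - δ))) := by
  have hR0 : 0 < R := hδ.trans hR
  -- `Ω` is replaced by an almost everywhere equal measurable set that contains the larger disk as
  -- an honest subset.
  obtain ⟨Ω₀, -, hm₀, hae₀⟩ := hΩ.1.exists_measurable_superset_ae_eq
  set Ω₁ := Ω₀ ∪ Metric.ball a (2 * R) with hΩ₁
  have hm₁ : MeasurableSet Ω₁ := hm₀.union measurableSet_ball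
  have hae : Ω₁ =ᵐ[volume] Ω := by
    filter_upwards [hae₀.mem_iff, hd.ball_ae_le le_rfl] with x h1 h2
    exact propext ⟨fun h => h.elim h1.1 h2, fun h => Or.inl (h1.2 h)⟩
  have haeA : (Ω₁ \ Metric.ball a R : Set Plane) =ᵐ[volume] (Ω \ Metric.ball a R : Set Plane) :=
    hae.diff EventuallyEq.rfl
  have hsub : Metric.ball a (2 * R) ⊆ Ω₁ := subset_union_right
  have hBsub : Metric.ball a R ⊆ Ω₁ := (Metric.ball_subset_ball (by linarith)).trans hsub
  have hB := hasFinitePerimeter_ball a hR0.le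
  have hΩ₁P : HasFinitePerimeter Ω₁ := ⟨hm₁.nullMeasurableSet, by
    rw [perimeter_congr hae]; exact hΩ.2⟩
  have hA := hΩ₁P.diff hB measurableSet_ball hBsub.eventuallyLE
  rw [← energy_congr lam δ haeA, ← energy_congr lam δ hae]
  have p1 : (perimeter (Ω₁ \ Metric.ball a R)).toReal ≤
      (perimeter Ω₁).toReal + 2 * Real.pi * R := by
    have := (perimeter_diff_le measurableSet_ball hBsub.eventuallyLE).trans
      (add_le_add_right (perimeter_ball_le a hR0.le) (perimeter Ω₁))
    refine (ENNReal.toReal_mono (ENNReal.add_ne_top.2 ⟨hΩ₁P.2.ne, ENNReal.ofReal_ne_top⟩)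
      this).trans_eq ?_
    rw [ENNReal.toReal_add hΩ₁P.2.ne ENNReal.ofReal_ne_top,
      ENNReal.toReal_ofReal (by positivity)]
  have p2 : (perimeter (Metric.ball (0 : Plane) R)).toReal ≤ 2 * Real.pi * R :=
    ENNReal.toReal_le_of_le_ofReal (by positivity) (perimeter_ball_le 0 hR0.le)
  have hN := nonlocalTerm_diff_add δ hm₁ measurableSet_ball hBsub
  have fA := hA.nonlocalTerm_lt_top hδ
  have fB := hB.nonlocalTerm_lt_top hδ
  have fΩ := hΩ₁P.nonlocalTerm_lt_top hδ
  have hge := mul_le_mul_right ((interaction_ball_annulus_ge hδ hR a).trans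
    (interaction_mono subset_rfl (sdiff_subset_sdiff_left (t := Metric.ball a R) hsub))) 4
  have hge' := add_le_add_right hge (nonlocalTerm δ Ω₁)
  rw [← hN] at hge'
  have hreal := ENNReal.toReal_mono (ENNReal.add_lt_top.2 ⟨fA, fB⟩).ne hge'
  set j := 2 * Real.pi * (2 * R * Real.log (R / δ) - (R - δ))
  rw [ENNReal.toReal_add fΩ.ne (ENNReal.mul_ne_top (by simp) ENNReal.ofReal_ne_top),
    ENNReal.toReal_add fA.ne fB.ne, ENNReal.toReal_mul, ENNReal.toReal_ofReal',
    nonlocalTerm_ball] at hreal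
  have hmax := le_max_left j 0
  simp only [ENNReal.toReal_ofNat] at hreal
  have hk : 0 ≤ lam / (4 * |Real.log δ|) := by positivity
  have hmul := mul_le_mul_of_nonneg_left
    (show (nonlocalTerm δ Ω₁).toReal + 4 * j ≤ (nonlocalTerm δ (Ω₁ \ Metric.ball a R)).toReal +
      (nonlocalTerm δ (Metric.ball 0 R)).toReal by linarith) hk
  have hk4 : lam / (4 * |Real.log δ|) * (4 * j) = lam / |Real.log δ| * j := by
    rw [mul_comm 4 |Real.log δ|, ← div_div]; ring
  rw [mul_add, mul_add, hk4] at hmul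
  unfold energy
  linarith

/-- The exponent `(lam - 1) / lam` is the one for which `log(R/δ)` reaches `|log δ|/lam`, where the
leading terms of both sides coincide. The factor `2` in front supplies the extra `log 2` that makes
the inequality strict. -/
lemma lt_interaction_bound {lam δ R : ℝ} (hlam : 1 < lam) (hδ : 0 < δ) (hδ1 : δ < 1)
    (hR : 2 * δ ^ ((lam - 1) / lam) ≤ R) :
    δ < R ∧ 4 * Real.pi * R < lam / |Real.log δ| *
      (2 * Real.pi * (2 * R * Real.log (R / δ) - (R - δ))) := by
  have hlam0 : 0 < lam := by linarith
  have hL : Real.log δ < 0 := Real.log_neg hδ hδ1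
  have hpow : 0 < δ ^ ((lam - 1) / lam) := Real.rpow_pos_of_pos hδ _
  have hR0 : 0 < R := by linarith
  have hlog : Real.log 2 + (lam - 1) / lam * Real.log δ ≤ Real.log R := by
    rw [← Real.log_rpow hδ, ← Real.log_mul two_ne_zero hpow.ne']
    exact Real.log_le_log (by positivity) hR
  have hsplit : (lam - 1) / lam * Real.log δ = Real.log δ + -Real.log δ / lam := by
    field_simp; ring
  have hdiv : Real.log 2 + -Real.log δ / lam ≤ Real.log (R / δ) := by
    rw [Real.log_div hR0.ne' hδ.ne']; linarith
  have hlog2 := Real.log_two_gt_d9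
  have hLpos : 0 < -Real.log δ / lam := div_pos (by linarith) hlam0
  have hlt : δ < R := by
    have : 0 < Real.log (R / δ) := by linarith
    rw [Real.log_pos_iff (by positivity), one_lt_div hδ] at this
    exact this
  refine ⟨hlt, ?_⟩
  rw [abs_of_neg hL, div_mul_eq_mul_div, lt_div_iff₀ (by linarith)]
  -- `2 log 2 > 1`, so the surplus `2R log 2` exceeds `R - δ`.
  have h1 : 2 * R * (-Real.log δ / lam) < 2 * R * Real.log (R / δ) - (R - δ) := by
    nlinarith
  calc 4 * Real.pi * R * -Real.log δ
      = lam * (2 * Real.pi * (2 * R * (-Real.log δ / lam))) := by field_simp; ring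
    _ < _ := by
      have := Real.pi_pos
      gcongr

lemma exists_ball_split {lam δ : ℝ} (hlam : 1 < lam) (hδ : 0 < δ) (hδ1 : δ < 1)
    {Ω : Set Plane} {a : Plane} {r : ℝ} (hΩ : HasFinitePerimeter Ω)
    (hr : 4 * δ ^ ((lam - 1) / lam) ≤ r) (hd : ContainsDisk Ω a r) :
    ∃ r' : ℝ, 0 < r' ∧ r' < r ∧ HasFinitePerimeter (Ω \ Metric.ball a r') ∧
      volume Ω = volume (Ω \ Metric.ball a r') + volume (Metric.ball (0 : Plane) r') ∧
      energy lam δ (Ω \ Metric.ball a r') + energy lam δ (Metric.ball (0 : Plane) r') <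
        energy lam δ Ω := by
  obtain ⟨R, rfl⟩ : ∃ R, r = 2 * R := ⟨r / 2, by ring⟩
  obtain ⟨hlt, hb⟩ := lt_interaction_bound (R := R) hlam hδ hδ1 (by linarith)
  have hR0 : 0 < R := hδ.trans hlt
  have hle := hd.ball_ae_le (show R ≤ 2 * R by linarith)
  refine ⟨R, hR0, by linarith, hΩ.diff (hasFinitePerimeter_ball a hR0.le) measurableSet_ball hle,
    ?_, ?_⟩
  · have hinter : (Ω ∩ Metric.ball a R : Set Plane) =ᵐ[volume] Metric.ball a R := by
      filter_upwards [hle] with x hx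
      exact propext ⟨fun h => h.2, fun h => ⟨hx h, h⟩⟩
    rw [← measure_inter_add_sdiff Ω measurableSet_ball, measure_congr hinter, add_comm]
    congr 1
    simp only [EuclideanSpace.volume_ball_fin_two]
  · have := energy_split_ball_le (lam := lam) (by linarith) hδ hlt hΩ hd
    linarith

/-! ### Consequences for generalized minimizers. -/

/-- The remainder `s` is the sum over the untouched indices. Finite support avoids any summability
question, and a general `M` serves both areas in `ℝ≥0∞` and real energies. -/
lemma exists_tsum_eq_add_and_tsum_update_eq_add {M : Type*} [AddCommMonoid M]
    [TopologicalSpace M] {f : ℕ → M} {i j : ℕ} (hij : i ≠ j)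
    (hf : (Function.support f).Finite) (hj : f j = 0) (u v : M) :
    ∃ s : M, ∑' k, f k = f i + s ∧
      ∑' k, Function.update (Function.update f i u) j v k = (u + v) + s := by
  classical
  set T : Finset ℕ := (hf.toFinset.erase i).erase j
  have hiT : i ∉ insert j T := by simp [T, hij]
  have hjT : j ∉ T := by simp [T]
  have hsupp : ∀ k ∉ insert i (insert j T), f k = 0 := by
    intro k hk
    simp only [T, Finset.mem_insert, Finset.mem_erase, Finite.mem_toFinset,
      Function.mem_support] at hk
    tauto
  refine ⟨∑ k ∈ T, f k, ?_, ?_⟩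
  · rw [tsum_eq_sum hsupp, Finset.sum_insert hiT, Finset.sum_insert hjT, hj, zero_add]
  · rw [tsum_eq_sum (s := insert i (insert j T)), Finset.sum_insert hiT, Finset.sum_insert hjT,
      Function.update_self, Function.update_of_ne hij, Function.update_self, add_assoc]
    · congr 2
      refine Finset.sum_congr rfl fun k hk => ?_
      have hkj : k ≠ j := fun h => hjT (h ▸ hk)
      have hki : k ≠ i := fun h => hiT (Finset.mem_insert_of_mem (h ▸ hk))
      rw [Function.update_of_ne hkj, Function.update_of_ne hki]
    · intro k hk
      have hk' := hk
      simp only [Finset.mem_insert, not_or] at hk'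
      rw [Function.update_of_ne hk'.2.1, Function.update_of_ne hk'.1, hsupp k hk]

/-- No component of a generalized minimizer can be split with a gain of energy. -/
lemma not_isGeneralizedMinimizer_of_split {E : Set Plane → ℝ}
    (hE : ∀ A, volume A = 0 → E A = 0) {m : ℝ} {Ω : ℕ → Set Plane} {i : ℕ}
    {A B : Set Plane} (hA : HasFinitePerimeter A) (hB : HasFinitePerimeter B)
    (hpos : volume (Ω i) ≠ 0) (hvol : volume (Ω i) = volume A + volume B)
    (hlt : E A + E B < E (Ω i)) : ¬ IsGeneralizedMinimizer E m Ω := by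
  rintro ⟨⟨hfp, hfin, hsum⟩, hmin⟩
  -- Only finitely many components have positive area, so some slot `j` is null; it carries no
  -- energy by `hE` and can receive `B`.
  obtain ⟨j, hj⟩ := hfin.exists_notMem
  have hj0 : volume (Ω j) = 0 := by simpa using hj
  have hij : i ≠ j := by
    rintro rfl
    exact hpos hj0
  have hsv : (Function.support fun k => volume (Ω k)).Finite :=
    hfin.subset fun k hk => pos_iff_ne_zero.2 hk
  have hsE : (Function.support fun k => E (Ω k)).Finite :=
    hfin.subset fun k hk => pos_iff_ne_zero.2 fun h => hk (hE _ h)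
  set Ω' : ℕ → Set Plane := Function.update (Function.update Ω i A) j B
  have hcomp : ∀ {M : Type} (F : Set Plane → M), (fun k => F (Ω' k)) =
      Function.update (Function.update (fun k => F (Ω k)) i (F A)) j (F B) := fun F =>
    (Function.comp_update F _ j B).trans
      (congrArg (fun g => Function.update g j (F B)) (Function.comp_update F Ω i A))
  obtain ⟨s, hs1, hs2⟩ := exists_tsum_eq_add_and_tsum_update_eq_add hij hsv hj0
    (volume A) (volume B)
  obtain ⟨t, ht1, ht2⟩ := exists_tsum_eq_add_and_tsum_update_eq_add hij hsE (hE _ hj0)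
    (E A) (E B)
  have hmem : Ω' ∈ SA m := by
    refine ⟨fun k => ?_, ?_, ?_⟩
    · by_cases hkj : k = j
      · subst hkj; simpa [Ω'] using hB
      · by_cases hki : k = i
        · subst hki; simpa [Ω', hkj] using hA
        · simpa [Ω', hkj, hki] using hfp k
    · refine (hfin.union (toFinite {i, j})).subset fun k hk => ?_
      by_cases hkj : k = j
      · exact Or.inr (by simp [hkj])
      · by_cases hki : k = i
        · exact Or.inr (by simp [hki])
        · exact Or.inl (by simpa [Ω', hkj, hki] using hk)
    · rw [hcomp fun S => volume S, hs2, ← hvol, ← hs1, hsum]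
  have hle := hmin Ω' hmem
  simp only [sumEnergy] at hle
  rw [hcomp E, ht2, ht1] at hle
  linarith

lemma not_containsDisk_of_isGeneralizedMinimizer {lam δ : ℝ} (hlam : 1 < lam) (hδ : 0 < δ)
    (hδ1 : δ < 1) {m : ℝ} {Ω : ℕ → Set Plane}
    (hmin : IsGeneralizedMinimizer (energy lam δ) m Ω) (i : ℕ) (a : Plane) {r : ℝ}
    (hr : 4 * δ ^ ((lam - 1) / lam) ≤ r) : ¬ ContainsDisk (Ω i) a r := by
  intro hd
  obtain ⟨r', h0, -, hfp, hvol, hlt⟩ := exists_ball_split hlam hδ hδ1 (hmin.1.1 i) hr hd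
  refine not_isGeneralizedMinimizer_of_split (fun A hA => energy_eq_zero_of_null lam δ hA) hfp
    (hasFinitePerimeter_ball 0 h0.le) ?_ hvol hlt hmin
  have hball : 0 < volume (Metric.ball (0 : Plane) r') := Metric.measure_ball_pos _ _ h0
  rw [hvol]
  exact (hball.trans_le le_add_self).ne'

end Dipolar

theorem mainTheorem9 :
    ∃ C : ℝ, 0 < C ∧ ∀ lam : ℝ, 1 < lam →
      (∃ δ₀ : ℝ, 0 < δ₀ ∧ ∀ δ : ℝ, 0 < δ → δ < δ₀ →
        (∀ (Ω : Set Dipolar.Plane) (a : Dipolar.Plane) (r : ℝ),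
          Dipolar.HasFinitePerimeter Ω →
          C * δ ^ ((lam - 1) / lam) ≤ r →
          Dipolar.ContainsDisk Ω a r →
          ∃ r' : ℝ, 0 < r' ∧ r' < r ∧
            Dipolar.HasFinitePerimeter (Ω \ Metric.ball a r') ∧
            MeasureTheory.volume Ω =
              MeasureTheory.volume (Ω \ Metric.ball a r') +
                MeasureTheory.volume (Metric.ball (0 : Dipolar.Plane) r') ∧
            Dipolar.energy lam δ (Ω \ Metric.ball a r') +
                Dipolar.energy lam δ (Metric.ball (0 : Dipolar.Plane) r') <
              Dipolar.energy lam δ Ω) ∧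
        (∀ (m : ℝ) (Ω : ℕ → Set Dipolar.Plane), 0 < m →
          Dipolar.IsGeneralizedMinimizer (Dipolar.energy lam δ) m Ω →
          ∀ (i : ℕ) (a : Dipolar.Plane) (r : ℝ),
            C * δ ^ ((lam - 1) / lam) ≤ r → ¬ Dipolar.ContainsDisk (Ω i) a r)) ∧
      (∀ ρ : ℝ, 0 < ρ → ∃ δ₁ : ℝ, 0 < δ₁ ∧ ∀ δ : ℝ, 0 < δ → δ < δ₁ →
        ∀ (m : ℝ) (Ω : ℕ → Set Dipolar.Plane), 0 < m →
          Dipolar.IsGeneralizedMinimizer (Dipolar.energy lam δ) m Ω →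
          ∀ (i : ℕ) (a : Dipolar.Plane), ¬ Dipolar.ContainsDisk (Ω i) a ρ) := by
  -- The constant is `4 = 2 · 2`: one factor from `R = r / 2`, the other from the gain of `log 2`.
  -- The threshold `δ₀ = 1` only ensures `log δ < 0`.
  refine ⟨4, by norm_num, fun lam hlam => ⟨⟨1, one_pos, fun δ hδ hδ1 => ⟨?_, ?_⟩⟩, ?_⟩⟩
  · intro Ω a r hΩ hr hd
    exact Dipolar.exists_ball_split hlam hδ hδ1 hΩ hr hd
  · intro m Ω _ hmin i a r hr
    exact Dipolar.not_containsDisk_of_isGeneralizedMinimizer hlam hδ hδ1 hmin i a hr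
  · intro ρ hρ
    have hexp : 0 < (lam - 1) / lam := div_pos (by linarith) (by linarith)
    -- The second bound solves `4 δ^((lam-1)/lam) = ρ` for `δ`.
    refine ⟨min 1 ((ρ / 4) ^ ((lam - 1) / lam)⁻¹), by positivity, ?_⟩
    intro δ hδ hδ1 m Ω _ hmin i a
    obtain ⟨h1, h2⟩ := lt_min_iff.1 hδ1
    refine Dipolar.not_containsDisk_of_isGeneralizedMinimizer hlam hδ h1 hmin i a ?_
    have h3 := Real.rpow_le_rpow hδ.le h2.le hexp.le
    rw [Real.rpow_inv_rpow (by positivity) hexp.ne'] at h3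
    linarith
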